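/- **Setting.** Let $L=\{L(A)\}$ be a homogeneous Lévy basis on $\mathbb R^2$ over a probability space, indexed by the Borel sets $A$ of finite Lebesgue measure: $L$ is an infinitely divisible, independently scattered random measure (values on pairwise disjoint sets are mutually independent, and $L$ is a.s. $\sigma$-additive) with $\mathbb E\,e^{izL(A)}=e^{\mathrm{Leb}(A)\psi(z)}$, where $\psi$ is the Lévy–Khintchine exponent of a triplet $(\gamma,b,\nu)$, $$\psi(z)=i\gamma z-\tfrac12 b^2z^2+\int_{\mathbb R\setminus\{0\}}\bigl(e^{izx}-1-izx\mathbf 1_{|x|\le1}\bigr)\,\nu(dx).$$ The triplet is *strictly $\beta$-stable with parameters* $(\beta,K_+,K_-,\gamma)$, where $0<\beta<2$, $K_\pm\ge0$, $K_++K_->0$, if $b=0$, $\nu(dx)=\bigl(K_+\mathbf 1_{\{x>0\}}+K_-\mathbf 1_{\{x<0\}}\bigr)|x|^{-1-\beta}dx$, and either $\beta\ne1$ and $\gamma=(K_+-K_-)/(1-\beta)$, or $\beta=1$, $K_+=K_-$ and $\gamma$ is arbitrary. Write $\psi(\cdot\,;\beta,K_+,K_-,\gamma)$ for the corresponding exponent.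 Assume that $L$ is strictly $\beta$-stable with parameters $(\beta,K_+,K_-,\gamma)$. Let $2<\kappa<3$, $c_a>0$, and let $a':[0,\infty)\to(0,\infty)$ be continuous with $a'(tx)/a'(t)\to x^{-\kappa}$ as $t\to\infty$ for every $x>0$ and $a'(y)\sim c_a y^{-\kappa}$ as $y\to\infty$. Put $a(s)=\int_s^\infty a'(y)\,dy$ for $s\ge0$, $A=\{(r,y):r\le0,\ 0\le y\le a(-r)\}$, $A_t=A+(t,0)$ and $X_t=L(A_t)$. Let $\Delta_n\ge0$ with $\Delta_n\to0$ and $n\Delta_n\to\infty$, and put $$\mathbf S^n_t=\sum_{k=0}^{[nt]-1}\bigl(X_{k\Delta_n}-\mathbb E X_{k\Delta_n}\bigr),\qquad t\ge0.$$ **Theorem.** (i) If $1<\beta<\kappa-1$, then $\varrho_a:=\int_0^\infty s^\beta a'(s)\,ds<\infty$ and, as $n\to\infty$, the finite-dimensional distributions of $\dfrac{\Delta_n}{(n\Delta_n)^{1/\beta}}\mathbf S^n$ converge weakly to those of $Y$, where $Y$ is a strictly $\beta$-stable Lévy process with $\mathbb E\,e^{izY_1}=\exp\psi(z;\beta,\varrho_aK_+,\varrho_aK_-,\varrho_a\gamma)$.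 (Such a process exists, and the convergence holds for every such $Y$.) (ii) If $\kappa-1<\beta<2$, then, as $n\to\infty$, $$\frac{1}{n\,\bigl(a(n\Delta_n)\,n\Delta_n\bigr)^{1/\beta}}\,\mathbf S^n_1\ \xrightarrow{\ d\ }\ \xi,$$ where $\xi$ is a strictly $\beta$-stable random variable with $\mathbb E\,e^{iz\xi}=\exp\psi(z;\beta,\varrho K_+,\varrho K_-,\varrho\gamma)$ and $$\varrho=\frac1{\kappa-2}+(\kappa-1)\int_0^1(1-s)s^{\beta-\kappa}\,ds+2\int_0^1s^{\beta-\kappa+1}\,ds .$$ -/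

import Mathlib

open MeasureTheory ProbabilityTheory Filter Topology
open scoped NNReal ENNReal

universe u

noncomputable section

namespace TrawlLimit

/-! ### Infinite divisibility, Lévy measures and strictly stable laws -/

/-- A law on `ℝ` is infinitely divisible if it has `n`-th convolution roots for all `n ≥ 1`. -/
def IsInfinitelyDivisible (μ : Measure ℝ) : Prop :=
  ∀ n : ℕ, 1 ≤ n → ∃ ρ : Measure ℝ, IsProbabilityMeasure ρ ∧
    ∀ z : ℝ, charFun ρ z ^ n = charFun μ z

/-- `ν` is a Lévy measure: `ν {0} = 0` and `∫ (1 ∧ x²) ν(dx) < ∞`. -/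
def IsLevyMeasure (ν : Measure ℝ) : Prop :=
  ν {0} = 0 ∧ ∫⁻ x, ENNReal.ofReal (min 1 (x ^ 2)) ∂ν < ∞

/-- The characteristic exponent of the triplet `(γ, b, ν)`:
`ψ(z) = iγz - b²z²/2 + ∫ (e^{izx} - 1 - izx 1_{|x| ≤ 1}) ν(dx)`. -/
def levyExponent (γ b : ℝ) (ν : Measure ℝ) (z : ℝ) : ℂ :=
  Complex.I * γ * z - (1 / 2 : ℂ) * (b : ℂ) ^ 2 * (z : ℂ) ^ 2 +
    ∫ x : ℝ, (Complex.exp (Complex.I * z * x) - 1 -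
      (if |x| ≤ 1 then Complex.I * z * x else 0)) ∂ν

/-- The measure with Lebesgue density
`K₊ |x|^{-1-β} 1_{x > 0} + K₋ |x|^{-1-β} 1_{x < 0}`. -/
def stableLevyMeasure (β Kp Km : ℝ) : Measure ℝ :=
  volume.withDensity fun x =>
    if 0 < x then ENNReal.ofReal (Kp * |x| ^ (-1 - β))
    else if x < 0 then ENNReal.ofReal (Km * |x| ^ (-1 - β))
    else 0

/-- `(γ, b, ν)` is the triplet of the strictly `β`-stable distribution with parameters
`(β, K₊, K₋, γ)`. -/
structure IsStrictlyStableTriplet (β Kp Km γ b : ℝ) (ν : Measure ℝ) : Prop where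
  index_pos : 0 < β
  index_lt_two : β < 2
  Kp_nonneg : 0 ≤ Kp
  Km_nonneg : 0 ≤ Km
  sum_pos : 0 < Kp + Km
  no_gaussian : b = 0
  levyMeasure_eq : ν = stableLevyMeasure β Kp Km
  drift_eq : β ≠ 1 → γ = (Kp - Km) / (1 - β)
  symmetric : β = 1 → Kp = Km

/-- `μ` is the strictly `β`-stable law with parameters `(β, K₊, K₋, γ)`. -/
def IsStrictlyStableLaw (μ : Measure ℝ) (β Kp Km γ : ℝ) : Prop :=
  IsProbabilityMeasure μ ∧
  IsStrictlyStableTriplet β Kp Km γ 0 (stableLevyMeasure β Kp Km) ∧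
  ∀ z : ℝ, charFun μ z =
    Complex.exp (levyExponent γ 0 (stableLevyMeasure β Kp Km) z)

/-! ### Lévy processes -/

/-- Lévy processes: start at `0`, independent and stationary increments, stochastic continuity. -/
structure IsLevyProcess {Ω : Type*} [MeasurableSpace Ω] (Y : ℝ≥0 → Ω → ℝ) (P : Measure Ω) :
    Prop where
  measurable : ∀ t, Measurable (Y t)
  start_zero : ∀ᵐ ω ∂P, Y 0 ω = 0
  indep_increments : HasIndepIncrements Y P
  stationary_increments : ∀ s t : ℝ≥0,
    IdentDistrib (fun ω => Y (s + t) ω - Y s ω) (Y t) P P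
  stochastically_continuous : ∀ t : ℝ≥0, TendstoInMeasure P Y (𝓝 t) (Y t)

/-- Lévy processes whose value at time `1` is strictly `β`-stable with the given parameters. -/
def IsStrictlyStableLevyProcess {Ω : Type*} [MeasurableSpace Ω] (Y : ℝ≥0 → Ω → ℝ)
    (P : Measure Ω) (β Kp Km γ : ℝ) : Prop :=
  IsLevyProcess Y P ∧ IsStrictlyStableLaw (P.map (Y 1)) β Kp Km γ

/-- Convergence of the finite-dimensional distributions of `Z n` to those of `Y`. -/
def TendstoFDD {Ω Ω' : Type*} [MeasurableSpace Ω] [MeasurableSpace Ω']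
    (Z : ℕ → ℝ≥0 → Ω → ℝ) (Y : ℝ≥0 → Ω' → ℝ)
    (P : Measure Ω) [IsProbabilityMeasure P] (P' : Measure Ω') [IsProbabilityMeasure P'] : Prop :=
  ∀ (k : ℕ) (t : Fin k → ℝ≥0),
    TendstoInDistribution (fun (n : ℕ) (ω : Ω) (j : Fin k) => Z n (t j) ω) atTop
      (fun (ω : Ω') (j : Fin k) => Y (t j) ω) (fun _ => P) P'

/-! ### Lévy bases and trawl processes -/

/-- `L` is a homogeneous Lévy basis on `ℝ²` with characteristic triplet `(γ, b, ν)`: an infinitely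
divisible independently scattered random measure with `E exp(izL(A)) = exp(Leb(A) ψ(z))`.
Only the values `L A` at Borel sets `A` of finite Lebesgue measure are meaningful. -/
structure IsHomogeneousLevyBasis {Ω : Type*} [MeasurableSpace Ω] (P : Measure Ω)
    (L : Set (ℝ × ℝ) → Ω → ℝ) (γ b : ℝ) (ν : Measure ℝ) : Prop where
  gaussian_nonneg : 0 ≤ b
  isLevyMeasure : IsLevyMeasure ν
  measurable : ∀ A, MeasurableSet A → volume A < ∞ → Measurable (L A)
  infinitelyDivisible : ∀ A, MeasurableSet A → volume A < ∞ →
    IsInfinitelyDivisible (P.map (L A))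
  independently_scattered : ∀ A : ℕ → Set (ℝ × ℝ), (∀ i, MeasurableSet (A i)) →
    (∀ i, volume (A i) < ∞) → Pairwise (Function.onFun Disjoint A) →
    iIndepFun (fun i => L (A i)) P
  sigma_additive : ∀ A : ℕ → Set (ℝ × ℝ), (∀ i, MeasurableSet (A i)) →
    Pairwise (Function.onFun Disjoint A) → volume (⋃ i, A i) < ∞ →
    ∀ᵐ ω ∂P, Tendsto (fun N => ∑ i ∈ Finset.range N, L (A i) ω) atTop (𝓝 (L (⋃ i, A i) ω))
  charFun_eq : ∀ A, MeasurableSet A → volume A < ∞ → ∀ z : ℝ,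
    charFun (P.map (L A)) z = Complex.exp (((volume A).toReal : ℂ) * levyExponent γ b ν z)

/-- The trawl set `A = {(r, y) : r ≤ 0, 0 ≤ y ≤ a(-r)}`. -/
def trawlSet (a : ℝ → ℝ) : Set (ℝ × ℝ) := {p | p.1 ≤ 0 ∧ 0 ≤ p.2 ∧ p.2 ≤ a (-p.1)}

/-- The shifted trawl set `A_t = A + (t, 0)`. -/
def trawlSetAt (a : ℝ → ℝ) (t : ℝ) : Set (ℝ × ℝ) := (fun p => p + (t, 0)) '' trawlSet a

/-- The trawl process `X_t = L(A_t)`. -/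
def trawlProcess {Ω : Type*} (L : Set (ℝ × ℝ) → Ω → ℝ) (a : ℝ → ℝ) (t : ℝ) : Ω → ℝ :=
  L (trawlSetAt a t)

/-- `S_m^Δ = ∑_{k=0}^{m-1} (X_{Δk} - E X_{Δk})`. -/
def partialSum {Ω : Type*} [MeasurableSpace Ω] (P : Measure Ω) (L : Set (ℝ × ℝ) → Ω → ℝ)
    (a : ℝ → ℝ) (Δ : ℝ) (m : ℕ) (ω : Ω) : ℝ :=
  ∑ k ∈ Finset.range m, (trawlProcess L a (Δ * k) ω - ∫ ω', trawlProcess L a (Δ * k) ω' ∂P)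

/-- The process `𝐒ⁿ_t = S_{[nt]}^{Δ_n}`, `t ≥ 0`. -/
def partialSumProcess {Ω : Type*} [MeasurableSpace Ω] (P : Measure Ω) (L : Set (ℝ × ℝ) → Ω → ℝ)
    (a : ℝ → ℝ) (Δ : ℕ → ℝ) (n : ℕ) (t : ℝ≥0) (ω : Ω) : ℝ :=
  partialSum P L a (Δ n) ⌊(n : ℝ≥0) * t⌋₊ ω

/-- `g` is regularly varying at infinity with index `α`, in the convention
`g(tx) / g(t) → x^{-α}` as `t → ∞`. -/
def IsRegularlyVaryingAtInfinity (g : ℝ → ℝ) (α : ℝ) : Prop :=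
  ∀ x : ℝ, 0 < x → Tendsto (fun t => g (t * x) / g t) atTop (𝓝 (x ^ (-α)))

/-- The long memory condition on the trawl function `a` (on `[0, ∞)`): `a(s) = ∫_s^∞ a'(y) dy`
with `a'` strictly positive, continuous, regularly varying of index `κ ∈ (2, 3)`, and
`a'(y) ∼ c y^{-κ}` for the constant `c > 0`. -/
structure IsLongMemoryTrawl (a a' : ℝ → ℝ) (κ c : ℝ) : Prop where
  two_lt : 2 < κ
  lt_three : κ < 3
  continuousOn : ContinuousOn a' (Set.Ici 0)
  pos : ∀ y, 0 ≤ y → 0 < a' y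
  regularlyVarying : IsRegularlyVaryingAtInfinity a' κ
  trawl_eq : ∀ s, 0 ≤ s → a s = ∫ y in Set.Ioi s, a' y
  const_pos : 0 < c
  equivalent : Asymptotics.IsEquivalent atTop a' fun y => c * y ^ (-κ)

/-- The constant `∫_0^∞ s^β a'(s) ds`. -/
def shortScale (a' : ℝ → ℝ) (β : ℝ) : ℝ := ∫ s in Set.Ioi (0 : ℝ), s ^ β * a' s

/-- The constant
`1/(κ-2) + (κ-1) ∫_0^1 (1-s) s^{β-κ} ds + 2 ∫_0^1 s^{β-κ+1} ds`. -/
def longScale (κ β : ℝ) : ℝ :=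
  1 / (κ - 2) + (κ - 1) * (∫ s in (0 : ℝ)..1, (1 - s) * s ^ (β - κ)) +
    2 * ∫ s in (0 : ℝ)..1, s ^ (β - κ + 1)

end TrawlLimit

end

namespace TrawlLimit

/-! ### Lévy bases: joint characteristic functions -/

section LevyBasis

variable {Ω : Type*} [MeasurableSpace Ω] {P : Measure Ω}
  {L : Set (ℝ × ℝ) → Ω → ℝ} {γ b : ℝ} {ν : Measure ℝ}

/-! Everything reduces to one formula for characteristic functions. Splitting the plane into the
atoms generated by finitely many sets `B i` gives `E exp(i ∑ c_i L(B_i)) = exp ∫ ψ(∑ c_i 1_{B_i}(u))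
du` (`IsHomogeneousLevyBasis.integral_exp_sum`). Since `a` is strictly decreasing, the plane can be
read in coordinates `(r, a(s))`, with Jacobian `a'(s)`, and there a point lies in `A_t` exactly when
`r ≤ t ≤ r + s`. Hence `∑_k 1_{A_{kδ}}` becomes the number of grid points in `[r, r + s]`, and the
log characteristic function of the partial sums is `∫ a'(s) ∫ ψ(∑ θ_j N_j(r, s)) dr ds`
(`integral_exp_sum_partialSum`).

Both regimes have `β > 1`, the second because `κ > 2`. The exponent `ψ` is then homogeneous of order
`β`, so the variables are centered and normalising constants pass through `ψ`. Up to an error `2δ`,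
`δ` times the grid count is the length of `[r, r + s]` inside the observation window.

For `β < κ - 1`, put `T = nΔ_n` and substitute `r = T x` only. A segment of fixed length `s` is
short compared with `T`, so its overlap with the window tends to `s 1_{(0,t)}(x)`, and the exponent
tends to `∫ s^β a'(s) ds` times `∫ ψ(∑ θ_j 1_{(0,t_j)}(x)) dx` (`tendsto_integral_shortScale`). This
is the exponent of the finite-dimensional laws of a Lévy process (`IsLevyProcess.integral_exp_sum`).

For `β > κ - 1` the long segments dominate, and `s = T σ` is rescaled as well. By Karamata, `T
a'(Tσ) / a(T) → (κ - 1) σ^{-κ}`, while the count divided by `n` tends to the overlap of `[x, x + σ]`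
with `[0, 1]`. The limit is `ψ(z)` times an explicit double integral, equal to `longScale`
(`tendsto_integral_longScale`, `integral_longScale`).

Dominated convergence rests on `|v|^β ≤ B^{β-1} v` for `0 ≤ v ≤ B`, combined with the exact value `m
s` of the integrated grid count. The limit objects are built from `L` itself, as its values on the
strips `(0, ρt] × [0, 1]`. -/

lemma levyExponent_zero (γ b : ℝ) (ν : Measure ℝ) : levyExponent γ b ν 0 = 0 := by
  simp [levyExponent]

lemma IsHomogeneousLevyBasis.ae_eq_zero_of_volume_eq_zero [IsProbabilityMeasure P]
    (hL : IsHomogeneousLevyBasis P L γ b ν)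
    {A : Set (ℝ × ℝ)} (hA : MeasurableSet A) (h0 : volume A = 0) : ∀ᵐ ω ∂P, L A ω = 0 := by
  have hfin : volume A < ∞ := by simp [h0]
  have hm := hL.measurable A hA hfin
  have hmap : P.map (L A) = Measure.dirac 0 := by
    have := Measure.isProbabilityMeasure_map (μ := P) hm.aemeasurable
    refine Measure.ext_of_charFun ?_
    ext z
    rw [hL.charFun_eq A hA hfin z]
    simp [h0]
  have : ∀ᵐ x ∂(P.map (L A)), x = 0 := by
    rw [hmap]; exact (ae_dirac_iff (p := fun x : ℝ => x = 0) (measurableSet_singleton 0)).2 rfl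
  exact ae_of_ae_map hm.aemeasurable this

lemma IsHomogeneousLevyBasis.union [IsProbabilityMeasure P]
    (hL : IsHomogeneousLevyBasis P L γ b ν)
    {A B : Set (ℝ × ℝ)} (hA : MeasurableSet A) (hB : MeasurableSet B) (hAf : volume A < ∞)
    (hBf : volume B < ∞) (hAB : Disjoint A B) :
    ∀ᵐ ω ∂P, L (A ∪ B) ω = L A ω + L B ω := by
  -- Finite additivity follows from σ-additivity by padding with empty sets, on which `L` vanishes
  -- almost surely because its characteristic function is 1.
  let S : ℕ → Set (ℝ × ℝ) := fun n => if n = 0 then A else if n = 1 then B else ∅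
  have hU : ⋃ i, S i = A ∪ B := by
    ext x
    simp only [Set.mem_iUnion, Set.mem_union, S]
    constructor
    · rintro ⟨i, hi⟩
      split_ifs at hi <;> simp_all
    · rintro (h | h)
      · exact ⟨0, by simpa using h⟩
      · exact ⟨1, by simpa using h⟩
  have hSm : ∀ i, MeasurableSet (S i) := by
    intro i; simp only [S]; split_ifs <;> simp_all
  have hd : Pairwise (Function.onFun Disjoint S) := by
    intro i j hij
    simp only [Function.onFun, S]
    split_ifs <;> simp_all [hAB.symm]
  have h1 := hL.sigma_additive S hSm hd (by
    rw [hU]; exact (measure_union_le A B).trans_lt (ENNReal.add_lt_top.2 ⟨hAf, hBf⟩))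
  have h2 := hL.ae_eq_zero_of_volume_eq_zero MeasurableSet.empty measure_empty
  filter_upwards [h1, h2] with ω h1 h2
  rw [hU] at h1
  refine tendsto_nhds_unique h1 (tendsto_const_nhds.congr' ?_)
  filter_upwards [eventually_ge_atTop 2] with N hN
  obtain ⟨k, rfl⟩ := Nat.exists_eq_add_of_le hN
  rw [Finset.sum_range_add]
  simp [S, Finset.sum_range_succ, h2, add_comm 2]

lemma IsHomogeneousLevyBasis.biUnion [IsProbabilityMeasure P]
    (hL : IsHomogeneousLevyBasis P L γ b ν)
    {ι : Type*} (B : ι → Set (ℝ × ℝ)) (hB : ∀ i, MeasurableSet (B i))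
    (hBf : ∀ i, volume (B i) < ∞) (hd : Pairwise (Function.onFun Disjoint B)) (s : Finset ι) :
    ∀ᵐ ω ∂P, L (⋃ i ∈ s, B i) ω = ∑ i ∈ s, L (B i) ω := by
  classical
  induction s using Finset.induction_on with
  | empty => simpa using hL.ae_eq_zero_of_volume_eq_zero MeasurableSet.empty measure_empty
  | insert i s hi ih =>
    have hU : ⋃ j ∈ insert i s, B j = B i ∪ ⋃ j ∈ s, B j := by
      simp
    have hdis : Disjoint (B i) (⋃ j ∈ s, B j) := by
      simp only [Set.disjoint_iUnion_right]
      intro j hj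
      exact hd (fun h => hi (h ▸ hj))
    have := hL.union (hB i) (Finset.measurableSet_biUnion s fun j _ => hB j) (hBf i)
      (measure_biUnion_lt_top s.finite_toSet fun j _ => hBf j) hdis
    filter_upwards [ih, this] with ω h1 h2
    rw [hU, h2]
    rw [h1, Finset.sum_insert hi]

lemma IsHomogeneousLevyBasis.iIndepFun_of_pairwise_disjoint
    (hL : IsHomogeneousLevyBasis P L γ b ν)
    {ι : Type*} [Finite ι] (B : ι → Set (ℝ × ℝ)) (hB : ∀ i, MeasurableSet (B i))
    (hBf : ∀ i, volume (B i) < ∞) (hd : Pairwise (Function.onFun Disjoint B)) :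
    iIndepFun (fun i => L (B i)) P := by
  classical
  obtain ⟨n, ⟨e⟩⟩ := Finite.exists_equiv_fin ι
  let S : ℕ → Set (ℝ × ℝ) := fun k => if h : k < n then B (e.symm ⟨k, h⟩) else ∅
  have hS : ∀ i, S (e i) = B i := fun i => by simp [S]
  have h := hL.independently_scattered S
    (fun k => by simp only [S]; split_ifs <;> simp [hB])
    (fun k => by simp only [S]; split_ifs <;> simp [hBf])
    (fun k l hkl => by
      simp only [Function.onFun, S]
      split_ifs
      · exact hd (fun h => hkl (by simpa using e.symm.injective h))
      all_goals simp)
  have h2 := h.precomp (g := fun i : ι => ((e i : Fin n) : ℕ))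
    (Fin.val_injective.comp e.injective)
  simpa [hS] using h2

lemma IsHomogeneousLevyBasis.integral_exp (hL : IsHomogeneousLevyBasis P L γ b ν)
    {A : Set (ℝ × ℝ)} (hA : MeasurableSet A) (hAf : volume A < ∞) (c : ℝ) :
    ∫ ω, Complex.exp (Complex.I * ((c * L A ω : ℝ) : ℂ)) ∂P =
      Complex.exp ((volume A).toReal * levyExponent γ b ν c) := by
  rw [← hL.charFun_eq A hA hAf c, charFun_apply_real,
    integral_map (hL.measurable A hA hAf).aemeasurable (by fun_prop)]
  congr 1; ext ω
  push_cast
  ring_nf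

/-- The part of `ℝ²` that belongs to exactly those `B i` with `i ∈ s`. -/
def atomSet {ι : Type*} (B : ι → Set (ℝ × ℝ)) (s : Finset ι) : Set (ℝ × ℝ) :=
  {u | ∀ i, u ∈ B i ↔ i ∈ s}

section Atoms

variable {ι : Type*} (B : ι → Set (ℝ × ℝ))

lemma measurableSet_atomSet [Fintype ι] (hB : ∀ i, MeasurableSet (B i)) (s : Finset ι) :
    MeasurableSet (atomSet B s) := by
  have : atomSet B s = ⋂ i, {u | u ∈ B i ↔ i ∈ s} := by ext; simp [atomSet]
  rw [this]
  refine MeasurableSet.iInter fun i => ?_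
  by_cases h : i ∈ s
  · simpa [h] using hB i
  · simp only [h, iff_false]
    exact (hB i).compl

lemma volume_atomSet_lt_top (hBf : ∀ i, volume (B i) < ∞) {s : Finset ι} (hs : s.Nonempty) :
    volume (atomSet B s) < ∞ := by
  obtain ⟨i, hi⟩ := hs
  exact (measure_mono fun u hu => (hu i).2 hi).trans_lt (hBf i)

lemma pairwise_disjoint_atomSet : Pairwise (Function.onFun Disjoint (atomSet B)) := by
  intro s t hst
  refine Set.disjoint_left.2 fun u hu hv => hst ?_
  ext i
  rw [← hu i, hv i]

lemma exists_mem_atomSet [Fintype ι] (u : ℝ × ℝ) : ∃ s, u ∈ atomSet B s := by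
  classical
  exact ⟨Finset.univ.filter fun i => u ∈ B i, fun i => by simp⟩

end Atoms

/-- The joint characteristic function of a Lévy basis at finitely many Borel sets. -/
theorem IsHomogeneousLevyBasis.integral_exp_sum [IsProbabilityMeasure P]
    (hL : IsHomogeneousLevyBasis P L γ b ν)
    {ι : Type*} [Fintype ι] (B : ι → Set (ℝ × ℝ)) (hB : ∀ i, MeasurableSet (B i))
    (hBf : ∀ i, volume (B i) < ∞) (c : ι → ℝ) :
    Integrable (fun u => levyExponent γ b ν (∑ i, c i * (B i).indicator (fun _ => (1 : ℝ)) u)) ∧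
    ∫ ω, Complex.exp (Complex.I * ((∑ i, c i * L (B i) ω : ℝ) : ℂ)) ∂P =
      Complex.exp (∫ u, levyExponent γ b ν
        (∑ i, c i * (B i).indicator (fun _ => (1 : ℝ)) u)) := by
  classical
  -- The atom of the empty index set is the complement of all `B i` and has infinite volume. It must
  -- be left out, and costs nothing: the combination is 0 there and `ψ 0 = 0`.
  let κ := {s : Finset ι // s.Nonempty}
  let D : κ → Set (ℝ × ℝ) := fun s => atomSet B s.1
  have hDm : ∀ s, MeasurableSet (D s) := fun s => measurableSet_atomSet B hB s.1
  have hDf : ∀ s, volume (D s) < ∞ := fun s => volume_atomSet_lt_top B hBf s.2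
  have hDd : Pairwise (Function.onFun Disjoint D) := fun s t hst =>
    pairwise_disjoint_atomSet B fun h => hst (Subtype.ext h)
  let C : κ → ℝ := fun s => ∑ i ∈ s.1, c i
  have hfun : (fun u => levyExponent γ b ν (∑ i, c i * (B i).indicator (fun _ => (1 : ℝ)) u))
      = fun u => ∑ s : κ, (D s).indicator (fun _ => levyExponent γ b ν (C s)) u := by
    ext u
    obtain ⟨s, hs⟩ := exists_mem_atomSet B u
    have h1 : ∑ i, c i * (B i).indicator (fun _ => (1 : ℝ)) u = ∑ i ∈ s, c i := by
      simp only [Set.indicator_apply, hs _, mul_ite, mul_one, mul_zero, Finset.sum_ite_mem,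
        Finset.univ_inter]
    rw [h1]
    rcases s.eq_empty_or_nonempty with rfl | hne
    · rw [Finset.sum_empty, levyExponent_zero, Finset.sum_eq_zero]
      intro t _
      refine Set.indicator_of_notMem (fun ht => ?_) _
      obtain ⟨i, hi⟩ := t.2
      simpa using (hs i).1 ((ht i).2 hi)
    · rw [Finset.sum_eq_single (⟨s, hne⟩ : κ)]
      · rw [Set.indicator_of_mem hs]
      · intro t _ ht
        exact Set.indicator_of_notMem (fun hu => (hDd ht).le_bot ⟨hu, hs⟩) _
      · simp
  have hint : ∀ s : κ, Integrable ((D s).indicator fun _ => levyExponent γ b ν (C s)) :=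
    fun s => (integrable_indicator_iff (hDm s)).2 (integrableOn_const (hDf s).ne)
  refine ⟨by rw [hfun]; exact integrable_finsetSum _ fun s _ => hint s, ?_⟩
  rw [hfun, integral_finsetSum _ fun s _ => hint s, Complex.exp_sum]
  have hdecomp : ∀ i, ∀ᵐ ω ∂P, L (B i) ω =
      ∑ s : κ, if i ∈ s.1 then L (D s) ω else 0 := by
    intro i
    have h := hL.biUnion D hDm hDf hDd (Finset.univ.filter fun s : κ => i ∈ s.1)
    have hU : ⋃ s ∈ (Finset.univ.filter fun s : κ => i ∈ s.1), D s = B i := by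
      ext u
      simp only [Set.mem_iUnion, Finset.mem_filter, Finset.mem_univ, true_and, exists_prop]
      constructor
      · rintro ⟨s, hs, hu⟩
        exact (hu i).2 hs
      · intro hu
        obtain ⟨s, hs⟩ := exists_mem_atomSet B u
        exact ⟨⟨s, ⟨i, (hs i).1 hu⟩⟩, (hs i).1 hu, hs⟩
    rw [hU] at h
    filter_upwards [h] with ω hω
    rw [hω, Finset.sum_filter]
  have hsum : ∀ᵐ ω ∂P, ∑ i, c i * L (B i) ω = ∑ s : κ, C s * L (D s) ω := by
    filter_upwards [ae_all_iff.2 hdecomp] with ω hω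
    simp only [hω, Finset.mul_sum]
    rw [Finset.sum_comm]
    refine Finset.sum_congr rfl fun s _ => ?_
    simp only [C, Finset.sum_mul, mul_ite, mul_zero, Finset.sum_ite_mem, Finset.univ_inter]
  have hind := hL.iIndepFun_of_pairwise_disjoint D hDm hDf hDd
  have hprod := hind.integral_fun_prod_comp
    (f := fun s x => Complex.exp (Complex.I * ((C s * x : ℝ) : ℂ)))
    (fun s => (hL.measurable _ (hDm s) (hDf s)).aemeasurable)
    (fun s => (by fun_prop : Continuous _).aestronglyMeasurable)
  have h1 : ∫ ω, Complex.exp (Complex.I * ((∑ i, c i * L (B i) ω : ℝ) : ℂ)) ∂P =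
      ∫ ω, ∏ s : κ, Complex.exp (Complex.I * ((C s * L (D s) ω : ℝ) : ℂ)) ∂P := by
    refine integral_congr_ae ?_
    filter_upwards [hsum] with ω hω
    rw [hω, ← Complex.exp_sum, Complex.ofReal_sum, Finset.mul_sum]
  rw [h1, hprod]
  refine Finset.prod_congr rfl fun s _ => ?_
  rw [hL.integral_exp (hDm s) (hDf s), integral_indicator (hDm s), setIntegral_const,
    Complex.real_smul]
  rfl

end LevyBasis

end TrawlLimit

namespace TrawlLimit

/-! ### The exponent of a strictly stable law of index in `(1, 2)` -/

section StableExponent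

/-- `e^{iu} - 1 - iu`. -/
noncomputable def expRemainder (u : ℝ) : ℂ :=
  Complex.exp (Complex.I * u) - 1 - Complex.I * u

lemma norm_expRemainder_le (u : ℝ) : ‖expRemainder u‖ ≤ 2 * |u| := by
  have h1 := Real.norm_exp_I_mul_ofReal_sub_one_le (x := u)
  have h2 : ‖Complex.I * (u : ℂ)‖ = |u| := by simp
  have h3 := norm_sub_le (Complex.exp (Complex.I * u) - 1) (Complex.I * u)
  rw [Real.norm_eq_abs] at h1
  unfold expRemainder
  linarith

lemma norm_expRemainder_le_sq (u : ℝ) : ‖expRemainder u‖ ≤ 2 * u ^ 2 := by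
  rcases le_total |u| 1 with h | h
  · have h2 : ‖Complex.I * (u : ℂ)‖ = |u| := by simp
    have h1 := Complex.norm_exp_sub_one_sub_id_le (x := Complex.I * u) (by rw [h2]; exact h)
    rw [h2, sq_abs] at h1
    unfold expRemainder
    nlinarith [sq_nonneg u]
  · have := norm_expRemainder_le u
    rw [← sq_abs]
    nlinarith

lemma continuous_expRemainder : Continuous expRemainder := by
  unfold expRemainder; fun_prop

variable {β : ℝ}

/-- Near 0 the remainder is quadratic, which needs `β < 2`; at infinity it is linear, which needs `β
> 1`. -/
lemma integrableOn_rpow_smul_expRemainder (h1 : 1 < β) (h2 : β < 2) (z : ℝ) :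
    IntegrableOn (fun x : ℝ => x ^ (-1 - β) • expRemainder (z * x)) (Set.Ioi 0) := by
  have hmeas : ∀ s ⊆ Set.Ioi (0 : ℝ), MeasurableSet s → AEStronglyMeasurable
      (fun x : ℝ => x ^ (-1 - β) • expRemainder (z * x)) (volume.restrict s) := by
    intro s _ _
    have h3 : Measurable fun x : ℝ => expRemainder (z * x) :=
      continuous_expRemainder.measurable.comp (measurable_const_mul z)
    have : Measurable fun x : ℝ => x ^ (-1 - β) • expRemainder (z * x) :=
      (measurable_id.pow_const (-1 - β)).smul h3
    exact this.aestronglyMeasurable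
  rw [← Set.Ioc_union_Ioi_eq_Ioi (zero_le_one' ℝ), integrableOn_union]
  constructor
  · have hi : IntegrableOn (fun x : ℝ => (2 * z ^ 2) * x ^ (1 - β)) (Set.Ioc 0 1) := by
      rw [← intervalIntegrable_iff_integrableOn_Ioc_of_le zero_le_one]
      exact (intervalIntegral.intervalIntegrable_rpow' (by linarith)).const_mul _
    refine hi.mono' (hmeas _ Set.Ioc_subset_Ioi_self measurableSet_Ioc) ?_
    filter_upwards [ae_restrict_mem measurableSet_Ioc] with x hx
    have hx0 : 0 < x := hx.1
    have := norm_expRemainder_le_sq (z * x)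
    have hp : 0 ≤ x ^ (-1 - β) := by positivity
    rw [norm_smul, Real.norm_of_nonneg hp,
      show (1 - β) = (-1 - β) + 2 by ring, Real.rpow_add hx0]
    calc x ^ (-1 - β) * ‖expRemainder (z * x)‖ ≤ x ^ (-1 - β) * (2 * (z * x) ^ 2) := by gcongr
      _ = _ := by norm_num; ring
  · have hi : IntegrableOn (fun x : ℝ => (2 * |z|) * x ^ (-β)) (Set.Ioi 1) :=
      (integrableOn_Ioi_rpow_of_lt (by linarith) one_pos).const_mul _
    refine hi.mono' (hmeas _ (Set.Ioi_subset_Ioi zero_le_one) measurableSet_Ioi) ?_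
    filter_upwards [ae_restrict_mem measurableSet_Ioi] with x hx
    have hx0 : 0 < x := zero_lt_one.trans hx
    have := norm_expRemainder_le (z * x)
    have hp : 0 ≤ x ^ (-1 - β) := by positivity
    rw [norm_smul, Real.norm_of_nonneg hp,
      show (-β) = (-1 - β) + 1 by ring, Real.rpow_add hx0]
    rw [abs_mul, abs_of_pos hx0] at this
    calc x ^ (-1 - β) * ‖expRemainder (z * x)‖ ≤ x ^ (-1 - β) * (2 * (|z| * x)) := by gcongr
      _ = _ := by rw [Real.rpow_one]; ring

/-- `∫_0^∞ (e^{izx} - 1 - izx) x^{-1-β} dx`. -/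
noncomputable def oneSidedExponent (β z : ℝ) : ℂ :=
  ∫ x in Set.Ioi (0 : ℝ), x ^ (-1 - β) • expRemainder (z * x)

/-- The substitution `x ↦ c x` multiplies `x^{-1-β} dx` by `c^{-β}`. This is the source of all
homogeneity below. -/
lemma oneSidedExponent_mul (β : ℝ) {c : ℝ} (hc : 0 < c) (z : ℝ) :
    oneSidedExponent β (c * z) = (c ^ β : ℝ) * oneSidedExponent β z := by
  have h := integral_comp_mul_left_Ioi
    (fun x : ℝ => x ^ (-1 - β) • expRemainder (z * x)) 0 hc
  rw [mul_zero] at h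
  have h' : ∫ x in Set.Ioi (0 : ℝ), (c * x) ^ (-1 - β) • expRemainder (z * (c * x)) =
      (c ^ (-1 - β) : ℝ) • oneSidedExponent β (c * z) := by
    rw [oneSidedExponent, ← integral_smul]
    refine setIntegral_congr_fun measurableSet_Ioi fun x hx => ?_
    have hx0 : (0 : ℝ) < x := hx
    simp only [smul_smul]
    rw [Real.mul_rpow hc.le hx0.le]
    ring_nf
  rw [h'] at h
  have hc' : c ^ (-1 - β) ≠ 0 := (Real.rpow_pos_of_pos hc _).ne'
  have : oneSidedExponent β (c * z) = (c ^ (-1 - β))⁻¹ • (c⁻¹ • oneSidedExponent β z) := by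
    rw [oneSidedExponent.eq_1 β z, ← h, smul_smul, inv_mul_cancel₀ hc', one_smul]
  rw [this, smul_smul, Complex.real_smul]
  congr 2
  rw [show (-1 - β) = -(1 + β) by ring, Real.rpow_neg hc.le, inv_inv, Real.rpow_add hc,
    Real.rpow_one]
  field_simp

lemma integral_stableLevyMeasure {Kp Km : ℝ} (hp : 0 ≤ Kp) (hm : 0 ≤ Km) (f : ℝ → ℂ)
    (hfp : IntegrableOn (fun x => x ^ (-1 - β) • f x) (Set.Ioi 0))
    (hfm : IntegrableOn (fun x => x ^ (-1 - β) • f (-x)) (Set.Ioi 0)) :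
    ∫ x, f x ∂(stableLevyMeasure β Kp Km) =
      Kp * (∫ x in Set.Ioi (0 : ℝ), x ^ (-1 - β) • f x) +
      Km * ∫ x in Set.Ioi (0 : ℝ), x ^ (-1 - β) • f (-x) := by
  set D : ℝ → ℝ≥0∞ := fun x =>
    if 0 < x then ENNReal.ofReal (Kp * |x| ^ (-1 - β))
    else if x < 0 then ENNReal.ofReal (Km * |x| ^ (-1 - β)) else 0 with hD
  have hDm : Measurable D := by
    refine Measurable.ite measurableSet_Ioi (by fun_prop)
      (Measurable.ite measurableSet_Iio (by fun_prop) measurable_const)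
  have hDf : ∀ᵐ x : ℝ, D x < ∞ := by
    refine ae_of_all _ fun x => ?_
    simp only [hD]; split_ifs <;> simp
  have hP : ∀ x ∈ Set.Ioi (0 : ℝ), (D x).toReal • f x = Kp • (x ^ (-1 - β) • f x) := by
    intro x hx
    have hx0 : (0 : ℝ) < x := hx
    simp only [hD, if_pos hx0, abs_of_pos hx0, smul_smul]
    rw [ENNReal.toReal_ofReal (by positivity)]
  have hM : ∀ x ∈ Set.Ioi (0 : ℝ), (D (-x)).toReal • f (-x) = Km • (x ^ (-1 - β) • f (-x)) := by
    intro x hx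
    have hx0 : (0 : ℝ) < x := hx
    have h1 : ¬ (0 < -x) := by linarith
    have h2 : -x < 0 := by linarith
    simp only [hD, if_neg h1, if_pos h2, abs_neg, abs_of_pos hx0, smul_smul]
    rw [ENNReal.toReal_ofReal (by positivity)]
  have hIp : IntegrableOn (fun x => (D x).toReal • f x) (Set.Ioi 0) :=
    (integrableOn_congr_fun hP measurableSet_Ioi).2 (hfp.smul Kp)
  have hIm' : IntegrableOn (fun x => (D (-x)).toReal • f (-x)) (Set.Ioi 0) :=
    (integrableOn_congr_fun hM measurableSet_Ioi).2 (hfm.smul Km)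
  have hIm : IntegrableOn (fun x => (D x).toReal • f x) (Set.Iic 0) := by
    have h := (Measure.measurePreserving_neg (volume : Measure ℝ)).integrableOn_comp_preimage
      (MeasurableEquiv.neg ℝ).measurableEmbedding (f := fun x => (D x).toReal • f x)
      (s := Set.Iio 0)
    rw [integrableOn_Iic_iff_integrableOn_Iio, ← h]
    simpa [Function.comp_def] using hIm'
  rw [stableLevyMeasure, integral_withDensity_eq_integral_toReal_smul hDm hDf,
    ← setIntegral_univ, ← Set.Iic_union_Ioi (a := (0 : ℝ)),
    setIntegral_union (Set.Iic_disjoint_Ioi le_rfl) measurableSet_Ioi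
      hIm hIp, setIntegral_congr_fun measurableSet_Ioi hP, integral_smul]
  have h3 := integral_comp_neg_Ioi 0 (fun x => (D x).toReal • f x)
  rw [neg_zero] at h3
  rw [← h3, setIntegral_congr_fun measurableSet_Ioi hM, integral_smul, add_comm]
  simp only [Complex.real_smul]

/-- Compensating on all of the half-line instead of on `|x| ≤ 1` changes each one-sided integral by
`iz ∫_1^∞ x^{-β} dx = iz/(β - 1)`, with opposite signs on the two sides. The strictly stable drift
is exactly the value that cancels the difference. -/
lemma levyExponent_stable (h1 : 1 < β) (h2 : β < 2) {Kp Km γ : ℝ} (hp : 0 ≤ Kp) (hm : 0 ≤ Km)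
    (hγ : γ = (Kp - Km) / (1 - β)) (z : ℝ) :
    levyExponent γ 0 (stableLevyMeasure β Kp Km) z =
      Kp * oneSidedExponent β z + Km * oneSidedExponent β (-z) := by
  set f : ℝ → ℂ := fun x => Complex.exp (Complex.I * z * x) - 1 -
      (if |x| ≤ 1 then Complex.I * z * x else 0) with hf
  have hfeq : ∀ w : ℝ, ∀ x ∈ Set.Ioi (0 : ℝ), x ^ (-1 - β) • (Complex.exp (Complex.I * w * x) - 1 -
      (if |x| ≤ 1 then Complex.I * w * x else 0)) =
      x ^ (-1 - β) • expRemainder (w * x) +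
        (Set.Ioi (1 : ℝ)).indicator (fun x : ℝ => x ^ (-β) • (Complex.I * w)) x := by
    intro w x hx
    have hx0 : (0 : ℝ) < x := hx
    simp only [expRemainder, Set.indicator_apply, Set.mem_Ioi, abs_of_pos hx0]
    rw [show (-β) = (-1 - β) + 1 by ring, Real.rpow_add hx0, Real.rpow_one]
    by_cases h : x ≤ 1
    · rw [if_pos h, if_neg (by linarith)]; push_cast; ring_nf
    · rw [if_neg h, if_pos (by linarith)]
      simp only [Complex.real_smul]
      push_cast; ring_nf
  have hind : ∀ w : ℝ, IntegrableOn
      ((Set.Ioi (1 : ℝ)).indicator (fun x : ℝ => x ^ (-β) • (Complex.I * w))) (Set.Ioi 0) := by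
    intro w
    have : IntegrableOn (fun x : ℝ => x ^ (-β) • (Complex.I * (w : ℂ))) (Set.Ioi 1) :=
      (integrableOn_Ioi_rpow_of_lt (by linarith) one_pos).smul_const _
    exact ((integrable_indicator_iff measurableSet_Ioi).2 this).integrableOn
  have hindv : ∀ w : ℝ, ∫ x in Set.Ioi (0 : ℝ),
      (Set.Ioi (1 : ℝ)).indicator (fun x : ℝ => x ^ (-β) • (Complex.I * w)) x =
      ((1 / (β - 1) : ℝ) : ℂ) * (Complex.I * w) := by
    intro w
    rw [setIntegral_indicator measurableSet_Ioi, Set.inter_eq_right.2 (Set.Ioi_subset_Ioi zero_le_one),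
      integral_smul_const, integral_Ioi_rpow_of_lt (by linarith) one_pos, Complex.real_smul]
    congr 2
    rw [Real.one_rpow, neg_div, ← div_neg]; ring_nf
  have hval : ∀ w : ℝ, IntegrableOn (fun x : ℝ => x ^ (-1 - β) •
      (Complex.exp (Complex.I * w * x) - 1 - (if |x| ≤ 1 then Complex.I * w * x else 0)))
      (Set.Ioi 0) ∧ ∫ x in Set.Ioi (0 : ℝ), x ^ (-1 - β) •
      (Complex.exp (Complex.I * w * x) - 1 - (if |x| ≤ 1 then Complex.I * w * x else 0)) =
      oneSidedExponent β w + ((1 / (β - 1) : ℝ) : ℂ) * (Complex.I * w) := by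
    intro w
    constructor
    · exact (integrableOn_congr_fun (hfeq w) measurableSet_Ioi).2
        ((integrableOn_rpow_smul_expRemainder h1 h2 w).add (hind w))
    · rw [setIntegral_congr_fun measurableSet_Ioi (hfeq w), integral_add
        (integrableOn_rpow_smul_expRemainder h1 h2 w) (hind w), hindv w]
      rfl
  have hneg : ∀ x : ℝ, f (-x) = Complex.exp (Complex.I * ((-z : ℝ) : ℂ) * x) - 1 -
      (if |x| ≤ 1 then Complex.I * ((-z : ℝ) : ℂ) * x else 0) := by
    intro x
    simp [hf]
  have hmain := integral_stableLevyMeasure hp hm f (hval z).1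
    (by simp_rw [hneg]; exact (hval (-z)).1)
  simp_rw [hneg] at hmain
  rw [(hval z).2, (hval (-z)).2] at hmain
  unfold levyExponent
  rw [hmain, hγ]
  have hb : ((β : ℂ) - 1) ≠ 0 := by
    rw [← Complex.ofReal_one, ← Complex.ofReal_sub, Complex.ofReal_ne_zero]; linarith
  have hb' : (1 - (β : ℂ)) ≠ 0 := by rw [← neg_sub]; exact neg_ne_zero.2 hb
  have hbb : (1 - (β : ℂ))⁻¹ = -(β - 1 : ℂ)⁻¹ := by rw [← neg_sub, inv_neg]
  push_cast
  simp only [div_eq_mul_inv, hbb]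
  ring

/-- An exponent that is homogeneous of order `β`, continuous, and `O(|z|^β)`. -/
structure IsHomogeneousExponent (β : ℝ) (ψ : ℝ → ℂ) : Prop where
  map_mul : ∀ c : ℝ, 0 ≤ c → ∀ z, ψ (c * z) = (c ^ β : ℝ) * ψ z
  continuous : Continuous ψ
  bound : ∃ C, 0 ≤ C ∧ ∀ z, ‖ψ z‖ ≤ C * |z| ^ β

lemma isHomogeneousExponent_levyExponent (h1 : 1 < β) (h2 : β < 2) {Kp Km γ : ℝ} (hp : 0 ≤ Kp)
    (hm : 0 ≤ Km) (hγ : γ = (Kp - Km) / (1 - β)) :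
    IsHomogeneousExponent β (levyExponent γ 0 (stableLevyMeasure β Kp Km)) := by
  set ψ := levyExponent γ 0 (stableLevyMeasure β Kp Km) with hψ
  have h0 : ψ 0 = 0 := levyExponent_zero _ _ _
  have hb0 : β ≠ 0 := by linarith
  have hmul : ∀ c : ℝ, 0 ≤ c → ∀ z, ψ (c * z) = (c ^ β : ℝ) * ψ z := by
    intro c hc z
    rcases hc.eq_or_lt with rfl | hc
    · simp [h0, Real.zero_rpow hb0]
    · simp only [hψ, levyExponent_stable h1 h2 hp hm hγ]
      rw [← mul_neg, oneSidedExponent_mul β hc, oneSidedExponent_mul β hc]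
      ring
  -- Homogeneity determines `ψ` from `ψ 1` and `ψ (-1)`, so continuity and the growth bound need no
  -- further analysis of the integral.
  have hform : ∀ z : ℝ, ψ z = ((max z 0) ^ β : ℝ) * ψ 1 + ((max (-z) 0) ^ β : ℝ) * ψ (-1) := by
    intro z
    rcases le_total 0 z with hz | hz
    · rw [max_eq_left hz, max_eq_right (by linarith), Real.zero_rpow hb0, ← hmul z hz]
      simp
    · rw [max_eq_right hz, max_eq_left (by linarith : 0 ≤ -z), Real.zero_rpow hb0,
        ← hmul (-z) (by linarith)]
      simp
  refine ⟨hmul, ?_, ‖ψ 1‖ + ‖ψ (-1)‖, by positivity, fun z => ?_⟩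
  · have : ψ = fun z : ℝ => ((max z 0) ^ β : ℝ) * ψ 1 + ((max (-z) 0) ^ β : ℝ) * ψ (-1) :=
      funext hform
    rw [this]
    have h3 : Continuous fun z : ℝ => (max z 0) ^ β :=
      (by fun_prop : Continuous fun z : ℝ => max z 0).rpow_const fun _ => Or.inr (by linarith)
    have h4 : Continuous fun z : ℝ => (max (-z) 0) ^ β :=
      (by fun_prop : Continuous fun z : ℝ => max (-z) 0).rpow_const fun _ => Or.inr (by linarith)
    exact ((Complex.continuous_ofReal.comp h3).mul continuous_const).add
      ((Complex.continuous_ofReal.comp h4).mul continuous_const)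
  · rcases le_total 0 z with hz | hz
    · have := hmul z hz 1
      rw [mul_one] at this
      rw [this, norm_mul, Complex.norm_real, Real.norm_of_nonneg (by positivity), abs_of_nonneg hz,
        mul_comm]
      gcongr
      linarith [norm_nonneg (ψ (-1))]
    · have := hmul (-z) (by linarith) (-1)
      rw [mul_neg_one, neg_neg] at this
      have h5 : 0 ≤ -z := by linarith
      rw [this, norm_mul, Complex.norm_real, Real.norm_of_nonneg (by positivity),
        abs_of_nonpos hz, mul_comm]
      gcongr
      linarith [norm_nonneg (ψ 1)]

lemma levyExponent_stable_smul (h1 : 1 < β) (h2 : β < 2) {Kp Km γ : ℝ} (hp : 0 ≤ Kp) (hm : 0 ≤ Km)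
    (hγ : γ = (Kp - Km) / (1 - β)) {ρ : ℝ} (hρ : 0 ≤ ρ) (z : ℝ) :
    levyExponent (ρ * γ) 0 (stableLevyMeasure β (ρ * Kp) (ρ * Km)) z =
      ρ * levyExponent γ 0 (stableLevyMeasure β Kp Km) z := by
  rw [levyExponent_stable h1 h2 (by positivity) (by positivity) (by rw [hγ]; ring),
    levyExponent_stable h1 h2 hp hm hγ]
  push_cast
  ring

lemma IsHomogeneousExponent.map_zero {ψ : ℝ → ℂ} (h : IsHomogeneousExponent β ψ) (hβ : 0 < β) :
    ψ 0 = 0 := by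
  have := h.map_mul 0 le_rfl 0
  rwa [zero_mul, Real.zero_rpow hβ.ne', Complex.ofReal_zero, zero_mul] at this

/-- Since `|ψ(z)| ≤ C |z|^β` with `β > 1`, `ψ` is `o(z)` at 0. A law with exponent proportional to
`ψ` therefore has mean 0. -/
lemma IsHomogeneousExponent.hasDerivAt_zero {ψ : ℝ → ℂ} (h : IsHomogeneousExponent β ψ)
    (hβ : 1 < β) : HasDerivAt ψ 0 0 := by
  obtain ⟨C, hC, hb⟩ := h.bound
  rw [hasDerivAt_iff_isLittleO]
  simp only [h.map_zero (by linarith), sub_zero, smul_zero]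
  have hO : ψ =O[𝓝 0] fun z : ℝ => |z| ^ (β - 1) * z := by
    refine Asymptotics.IsBigO.of_bound C (Eventually.of_forall fun z => (hb z).trans_eq ?_)
    rw [norm_mul, Real.norm_of_nonneg (by positivity), Real.norm_eq_abs]
    rcases eq_or_ne z 0 with rfl | hz
    · simp [Real.zero_rpow (by linarith : β ≠ 0)]
    · conv_rhs => rw [← Real.rpow_one |z|, Real.rpow_one |z|]
      rw [← Real.rpow_add_one (abs_pos.2 hz).ne']
      ring_nf
  refine hO.trans_isLittleO ?_
  have : (fun z : ℝ => |z| ^ (β - 1) * z) =o[𝓝 0] fun z : ℝ => (1 : ℝ) * z := by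
    refine Asymptotics.IsLittleO.mul_isBigO ?_ (Asymptotics.isBigO_refl _ _)
    rw [Asymptotics.isLittleO_one_iff]
    have hc : Continuous fun z : ℝ => |z| ^ (β - 1) :=
      continuous_abs.rpow_const fun _ => Or.inr (by linarith)
    have := hc.tendsto 0
    rwa [abs_zero, Real.zero_rpow (by linarith : β - 1 ≠ 0)] at this
  simpa using this

/-- A random variable with characteristic function `e^{vψ}` is centered if `ψ` is homogeneous
of order `β > 1`. -/
lemma integral_eq_zero_of_charFun {Ω : Type*} [MeasurableSpace Ω] {P : Measure Ω}
    [IsProbabilityMeasure P] {X : Ω → ℝ} (hX : Measurable X) {ψ : ℝ → ℂ}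
    (hψ : IsHomogeneousExponent β ψ) (hβ : 1 < β) (v : ℂ)
    (h : ∀ z, charFun (P.map X) z = Complex.exp (v * ψ z)) : ∫ ω, X ω ∂P = 0 := by
  -- A non-integrable variable has Bochner integral 0 by convention, so no moment estimate is
  -- needed. Otherwise the mean is read off the derivative of the characteristic function at 0.
  by_cases hi : Integrable X P
  swap
  · exact integral_undef hi
  have := Measure.isProbabilityMeasure_map (μ := P) hX.aemeasurable
  have hmem : MemLp id ((1 : ℕ) : ℝ≥0∞) (P.map X) := by
    rw [Nat.cast_one, memLp_one_iff_integrable]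
    exact (integrable_map_measure aestronglyMeasurable_id hX.aemeasurable).2 hi
  have h1 := iteratedDeriv_charFun_zero hmem
  rw [iteratedDeriv_one] at h1
  have h2 : HasDerivAt (charFun (P.map X)) 0 0 := by
    have h3 := ((hψ.hasDerivAt_zero hβ).const_mul v).cexp
    simp only [mul_zero] at h3
    exact h3.congr_of_eventuallyEq (Eventually.of_forall h)
  rw [h2.deriv, integral_map hX.aemeasurable (by fun_prop)] at h1
  simpa [Complex.I_ne_zero, eq_comm] using h1

end StableExponent

end TrawlLimit

namespace TrawlLimit

/-! ### The trawl function and the trawl set -/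

section TrawlFunction

variable {a a' : ℝ → ℝ} {κ c : ℝ}

namespace IsLongMemoryTrawl

/-- Continuity bounds `a'` on a compact interval, and the asymptotic equivalence bounds it beyond.
One constant serves every power `p ∈ [0, κ]`, which lets the domination in the long memory regime
use two powers at once. -/
lemma exists_le_rpow (ha : IsLongMemoryTrawl a a' κ c) :
    ∃ C, 0 < C ∧ (∀ y, 0 ≤ y → a' y ≤ C) ∧
      ∀ p, 0 ≤ p → p ≤ κ → ∀ y, 0 < y → a' y ≤ C * y ^ (-p) := by
  obtain ⟨C₁, hC₁, hO⟩ := ha.equivalent.isBigO.exists_pos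
  obtain ⟨Y, hY⟩ := eventually_atTop.1 (hO.bound.and (eventually_ge_atTop (1 : ℝ)))
  set Y₀ := max Y 1 with hY₀
  have hY1 : 1 ≤ Y₀ := le_max_right _ _
  obtain ⟨M, hM⟩ := isCompact_Icc.bddAbove_image
    (ha.continuousOn.mono (Set.Icc_subset_Ici_self : Set.Icc 0 Y₀ ⊆ Set.Ici 0))
  have hM' : ∀ y, 0 ≤ y → y ≤ Y₀ → a' y ≤ M := fun y h1 h2 =>
    hM (Set.mem_image_of_mem _ ⟨h1, h2⟩)
  have hM0 : 0 < M := (ha.pos 0 le_rfl).trans_le (hM' 0 le_rfl (by linarith))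
  have hκ := ha.two_lt
  have hc := ha.const_pos
  have hlarge : ∀ y, Y₀ ≤ y → a' y ≤ C₁ * c * y ^ (-κ) := by
    intro y hy
    have hy0 : 0 < y := by linarith
    have h := (hY y ((le_max_left _ _).trans hy)).1
    have h5 : 0 ≤ c * y ^ (-κ) := by positivity
    rw [Real.norm_of_nonneg (ha.pos y hy0.le).le, Real.norm_of_nonneg h5] at h
    linarith
  have hYp : 1 ≤ Y₀ ^ κ := Real.one_le_rpow hY1 (by linarith)
  refine ⟨C₁ * c + M * Y₀ ^ κ, by positivity, fun y hy => ?_, fun p hp hpκ y hy => ?_⟩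
  · rcases le_total y Y₀ with h | h
    · have h1 := hM' y hy h
      have h2 : 0 < C₁ * c := by positivity
      nlinarith
    · have h1 := hlarge y h
      have h2 : y ^ (-κ) ≤ 1 := Real.rpow_le_one_of_one_le_of_nonpos (by linarith) (by linarith)
      have h3 : 0 < C₁ * c := by positivity
      have h4 : 0 < M * Y₀ ^ κ := by positivity
      nlinarith
  · have hyp : 0 < y ^ (-p) := Real.rpow_pos_of_pos hy _
    rcases le_total y Y₀ with h | h
    · have h1 := hM' y hy.le h
      have h2 : Y₀ ^ (-κ) ≤ y ^ (-p) := by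
        calc Y₀ ^ (-κ) ≤ Y₀ ^ (-p) := Real.rpow_le_rpow_of_exponent_le hY1 (by linarith)
          _ ≤ y ^ (-p) := Real.rpow_le_rpow_of_nonpos hy h (by linarith)
      have h3 : Y₀ ^ κ * Y₀ ^ (-κ) = 1 := by
        rw [← Real.rpow_add (by linarith)]; simp
      have h4 : 1 ≤ Y₀ ^ κ * y ^ (-p) := by
        rw [← h3]; gcongr
      have h5 : 0 < C₁ * c * y ^ (-p) := by positivity
      nlinarith
    · have h1 := hlarge y h
      have h2 : y ^ (-κ) ≤ y ^ (-p) := Real.rpow_le_rpow_of_exponent_le (by linarith) (by linarith)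
      have h3 : 0 < C₁ * c := by positivity
      have h4 : 0 < M * Y₀ ^ κ * y ^ (-p) := by positivity
      nlinarith

lemma aestronglyMeasurable (ha : IsLongMemoryTrawl a a' κ c) :
    AEStronglyMeasurable a' (volume.restrict (Set.Ioi 0)) :=
  (ha.continuousOn.mono Set.Ioi_subset_Ici_self).aestronglyMeasurable measurableSet_Ioi

/-- Bounded near 0, of order `s^{q-κ}` at infinity. Used for `q = 0`, for `q = 1` (finite volume of
the trawl set) and for `q = β` (finiteness of `shortScale`). -/
lemma integrableOn_rpow_mul (ha : IsLongMemoryTrawl a a' κ c) {q : ℝ} (hq : 0 ≤ q)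
    (hqκ : q < κ - 1) : IntegrableOn (fun s => s ^ q * a' s) (Set.Ioi 0) := by
  obtain ⟨C, hC, hC0, hCp⟩ := ha.exists_le_rpow
  have hκ := ha.two_lt
  have hmeas : AEStronglyMeasurable (fun s => s ^ q * a' s) (volume.restrict (Set.Ioi 0)) :=
    (by fun_prop : Measurable fun s : ℝ => s ^ q).aestronglyMeasurable.mul ha.aestronglyMeasurable
  rw [← Set.Ioc_union_Ioi_eq_Ioi (zero_le_one' ℝ)] at hmeas ⊢
  rw [integrableOn_union]
  constructor
  · have hi : IntegrableOn (fun _ : ℝ => C) (Set.Ioc 0 1) := integrableOn_const (by simp)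
    refine hi.mono' (hmeas.mono_measure (Measure.restrict_mono Set.subset_union_left le_rfl)) ?_
    filter_upwards [ae_restrict_mem measurableSet_Ioc] with s hs
    have h1 : s ^ q ≤ 1 := Real.rpow_le_one hs.1.le hs.2 hq
    have h0 : 0 ≤ s ^ q := Real.rpow_nonneg hs.1.le _
    have h2 := hC0 s hs.1.le
    have h3 := (ha.pos s hs.1.le).le
    rw [Real.norm_of_nonneg (by positivity)]
    nlinarith
  · have hi : IntegrableOn (fun s : ℝ => C * s ^ (q - κ)) (Set.Ioi 1) :=
      (integrableOn_Ioi_rpow_of_lt (by linarith) one_pos).const_mul _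
    refine hi.mono' (hmeas.mono_measure (Measure.restrict_mono Set.subset_union_right le_rfl)) ?_
    filter_upwards [ae_restrict_mem measurableSet_Ioi] with s hs
    have hs0 : 0 < s := zero_lt_one.trans hs
    have h2 := hCp κ (by linarith) le_rfl s hs0
    have h3 := (ha.pos s hs0.le).le
    rw [Real.norm_of_nonneg (by positivity), sub_eq_add_neg, Real.rpow_add hs0]
    calc s ^ q * a' s ≤ s ^ q * (C * s ^ (-κ)) := by gcongr
      _ = _ := by ring

lemma integrableOn (ha : IsLongMemoryTrawl a a' κ c) : IntegrableOn a' (Set.Ioi 0) := by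
  simpa using ha.integrableOn_rpow_mul le_rfl (by linarith [ha.two_lt])

lemma intervalIntegrable (ha : IsLongMemoryTrawl a a' κ c) {s t : ℝ} (hs : 0 ≤ s) (ht : 0 ≤ t) :
    IntervalIntegrable a' volume s t :=
  (ha.continuousOn.mono fun x hx => by
    rcases Set.mem_uIcc.1 hx with h | h
    · exact hs.trans h.1
    · exact ht.trans h.1).intervalIntegrable

lemma eq_sub_integral (ha : IsLongMemoryTrawl a a' κ c) {s : ℝ} (hs : 0 ≤ s) :
    a s = a 0 - ∫ y in (0 : ℝ)..s, a' y := by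
  rw [ha.trawl_eq s hs, ha.trawl_eq 0 le_rfl,
    ← intervalIntegral.integral_Ioi_sub_Ioi ha.integrableOn hs]
  ring

lemma hasDerivAt (ha : IsLongMemoryTrawl a a' κ c) {s : ℝ} (hs : 0 < s) :
    HasDerivAt a (-a' s) s := by
  have hcont : ContinuousAt a' s := ha.continuousOn.continuousAt (Ici_mem_nhds hs)
  have h := intervalIntegral.integral_hasDerivAt_right (ha.intervalIntegrable le_rfl hs.le)
    ⟨Set.Ioi 0, Ioi_mem_nhds hs, ha.aestronglyMeasurable⟩ hcont
  refine (h.const_sub (a 0)).congr_of_eventuallyEq ?_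
  filter_upwards [Ioi_mem_nhds hs] with x hx
  exact ha.eq_sub_integral (le_of_lt hx)

lemma strictAntiOn (ha : IsLongMemoryTrawl a a' κ c) : StrictAntiOn a (Set.Ici 0) := by
  intro s hs t ht hst
  have hs' : (0 : ℝ) ≤ s := hs
  have ht' : (0 : ℝ) ≤ t := ht
  rw [ha.eq_sub_integral hs', ha.eq_sub_integral ht',
    ← intervalIntegral.integral_add_adjacent_intervals (ha.intervalIntegrable le_rfl hs')
      (ha.intervalIntegrable hs' ht')]
  have := intervalIntegral.intervalIntegral_pos_of_pos_on (ha.intervalIntegrable hs' ht')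
    (fun x hx => ha.pos x (hs'.trans hx.1.le)) hst
  linarith

lemma tendsto_zero (ha : IsLongMemoryTrawl a a' κ c) : Tendsto a atTop (𝓝 0) := by
  have h := intervalIntegral_tendsto_integral_Ioi 0 ha.integrableOn tendsto_id
  have h2 := h.const_sub (a 0)
  rw [← ha.trawl_eq 0 le_rfl, sub_self] at h2
  refine h2.congr' ?_
  filter_upwards [eventually_ge_atTop 0] with s hs
  exact (ha.eq_sub_integral hs).symm

lemma pos_apply (ha : IsLongMemoryTrawl a a' κ c) {s : ℝ} (hs : 0 ≤ s) : 0 < a s := by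
  have h1 : a (s + 1) < a s :=
    ha.strictAntiOn hs (by simp only [Set.mem_Ici]; linarith) (by linarith)
  have h2 : 0 ≤ a (s + 1) := by
    rw [ha.trawl_eq _ (by linarith)]
    refine setIntegral_nonneg measurableSet_Ioi fun x hx => (ha.pos x ?_).le
    have : s + 1 < x := hx
    linarith
  linarith

lemma continuousOn_apply (ha : IsLongMemoryTrawl a a' κ c) : ContinuousOn a (Set.Ici 0) := by
  intro s hs
  rcases (show (0 : ℝ) ≤ s from hs).eq_or_lt with rfl | hs'
  · have h : ContinuousOn (fun x => ∫ y in (0 : ℝ)..x, a' y) (Set.uIcc 0 1) :=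
      intervalIntegral.continuousOn_primitive_interval'
        (ha.intervalIntegrable le_rfl zero_le_one) (by simp)
    have h2 : ContinuousWithinAt (fun x => a 0 - ∫ y in (0 : ℝ)..x, a' y) (Set.Icc 0 1) 0 := by
      have := h 0 (by simp)
      rw [Set.uIcc_of_le zero_le_one] at this
      exact continuousWithinAt_const.sub this
    have h3 : ContinuousWithinAt a (Set.Icc 0 1) 0 :=
      h2.congr (fun x hx => ha.eq_sub_integral hx.1) (ha.eq_sub_integral le_rfl)
    exact h3.mono_of_mem_nhdsWithin (Icc_mem_nhdsGE one_pos)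
  · exact (ha.hasDerivAt hs').continuousAt.continuousWithinAt

/-- This makes `y = a(s)` a change of variables covering all relevant heights up to a null set. -/
lemma image_Ioi (ha : IsLongMemoryTrawl a a' κ c) : a '' Set.Ioi 0 = Set.Ioo 0 (a 0) := by
  ext y
  constructor
  · rintro ⟨s, hs, rfl⟩
    have hs' : (0 : ℝ) < s := hs
    exact ⟨ha.pos_apply hs'.le, ha.strictAntiOn Set.self_mem_Ici hs'.le hs'⟩
  · rintro ⟨h0, h1⟩
    obtain ⟨T, hT⟩ := ((ha.tendsto_zero.eventually_lt_const h0).and (eventually_gt_atTop 0)).exists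
    obtain ⟨s, hs, rfl⟩ := intermediate_value_Icc' hT.2.le
      (ha.continuousOn_apply.mono Set.Icc_subset_Ici_self) ⟨hT.1.le, h1.le⟩
    refine ⟨s, hs.1.lt_of_ne ?_, rfl⟩
    rintro rfl
    exact lt_irrefl _ h1

/-- Karamata's theorem for the tail integral: `t a'(tx) / a(t) → (κ - 1) x^{-κ}`. -/
lemma tendsto_density (ha : IsLongMemoryTrawl a a' κ c) {x : ℝ} (hx : 0 < x) :
    Tendsto (fun t => t * a' (t * x) / a t) atTop (𝓝 ((κ - 1) * x ^ (-κ))) := by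
  have hκ := ha.two_lt
  have hc := ha.const_pos
  have h1 : Tendsto (fun t => a' t / t ^ (-κ)) atTop (𝓝 c) := by
    have h := (Asymptotics.isEquivalent_iff_tendsto_one (by
      filter_upwards [eventually_gt_atTop 0] with y hy
      have := Real.rpow_pos_of_pos hy (-κ)
      positivity)).1 ha.equivalent
    have h2 := h.const_mul c
    rw [mul_one] at h2
    refine h2.congr' ?_
    filter_upwards [eventually_gt_atTop 0] with y hy
    have := Real.rpow_pos_of_pos hy (-κ)
    simp only [Pi.div_apply]
    field_simp
  have h2 : Tendsto (fun t => a t / t ^ (1 - κ)) atTop (𝓝 (c / (κ - 1))) := by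
    have hf : ∀ᶠ t in atTop, HasDerivAt a (-a' t) t := by
      filter_upwards [eventually_gt_atTop 0] with t ht using ha.hasDerivAt ht
    have hg : ∀ᶠ t : ℝ in atTop, HasDerivAt (fun t : ℝ => t ^ (1 - κ))
        ((1 - κ) * t ^ (1 - κ - 1)) t := by
      filter_upwards [eventually_gt_atTop 0] with t ht
      exact Real.hasDerivAt_rpow_const (Or.inl ht.ne')
    have hg' : ∀ᶠ t : ℝ in atTop, (1 - κ) * t ^ (1 - κ - 1) ≠ 0 := by
      filter_upwards [eventually_gt_atTop 0] with t ht
      exact mul_ne_zero (by linarith) (Real.rpow_pos_of_pos ht _).ne'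
    have hg0 : Tendsto (fun t : ℝ => t ^ (1 - κ)) atTop (𝓝 0) := by
      have := tendsto_rpow_neg_atTop (y := κ - 1) (by linarith)
      simpa using this
    -- L'Hôpital's rule turns `a'(t) ∼ c t^{-κ}` into `a(t) ∼ c t^{1-κ} / (κ - 1)`.
    refine HasDerivAt.lhopital_zero_atTop hf hg hg' ha.tendsto_zero hg0 ?_
    have h3 := h1.div_const (κ - 1)
    refine h3.congr' ?_
    filter_upwards [eventually_gt_atTop 0] with t ht
    have := Real.rpow_pos_of_pos ht (-κ)
    have h4 : κ - 1 ≠ 0 := by linarith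
    have h5 : 1 - κ ≠ 0 := by linarith
    rw [show 1 - κ - 1 = -κ by ring]
    field_simp
    ring
  have h3 : Tendsto (fun t => a' (t * x) / (t * x) ^ (-κ)) atTop (𝓝 c) :=
    h1.comp (tendsto_id.atTop_mul_const hx)
  have h4 := (h3.div h2 (div_ne_zero hc.ne' (by linarith))).mul_const (x ^ (-κ))
  have h5 : c / (c / (κ - 1)) = κ - 1 := by
    field_simp
  rw [h5] at h4
  refine h4.congr' ?_
  filter_upwards [eventually_gt_atTop 0] with t ht
  have := Real.rpow_pos_of_pos ht (-κ)
  have h6 := Real.rpow_pos_of_pos hx (-κ)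
  have h7 := ha.pos_apply ht.le
  simp only [Pi.div_apply]
  rw [Real.mul_rpow ht.le hx.le, show 1 - κ = -κ + 1 by ring, Real.rpow_add_one ht.ne']
  field_simp

end IsLongMemoryTrawl

/-! ### Trawl sets in the coordinates `(r, a(s))`. -/

lemma mem_trawlSetAt {t : ℝ} {p : ℝ × ℝ} :
    p ∈ trawlSetAt a t ↔ p.1 ≤ t ∧ 0 ≤ p.2 ∧ p.2 ≤ a (t - p.1) := by
  have : trawlSetAt a t = {p | p - (t, 0) ∈ trawlSet a} := by
    ext q
    constructor
    · rintro ⟨r, hr, rfl⟩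
      simpa using hr
    · intro hq
      exact ⟨q - (t, 0), hq, by simp⟩
  rw [this]
  simp [trawlSet]

namespace IsLongMemoryTrawl

/-- At height `a(s)`, strict monotonicity turns `a(s) ≤ a(t - r)` into `t - r ≤ s`. Membership in
shifted trawl sets thus becomes the event that `t` lies in the segment `[r, r + s]`. -/
lemma mem_trawlSetAt_apply (ha : IsLongMemoryTrawl a a' κ c) {s : ℝ} (hs : 0 ≤ s) (t r : ℝ) :
    (r, a s) ∈ trawlSetAt a t ↔ r ≤ t ∧ t ≤ r + s := by
  rw [mem_trawlSetAt]
  refine and_congr_right fun hr => ?_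
  have hr' : r ≤ t := hr
  have : t - r ∈ Set.Ici (0 : ℝ) := by simp only [Set.mem_Ici]; linarith
  simp only [(ha.pos_apply hs).le, true_and]
  rw [ha.strictAntiOn.le_iff_ge hs this]
  constructor <;> intro h <;> linarith

lemma snd_le_of_mem_trawlSetAt (ha : IsLongMemoryTrawl a a' κ c) {t : ℝ} {p : ℝ × ℝ}
    (hp : p ∈ trawlSetAt a t) : p.2 ∈ Set.Icc 0 (a 0) := by
  rw [mem_trawlSetAt] at hp
  have : 0 ≤ t - p.1 := by linarith [hp.1]
  exact ⟨hp.2.1, hp.2.2.trans (ha.strictAntiOn.antitoneOn Set.self_mem_Ici this this)⟩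

lemma measurableSet_trawlSetAt (ha : IsLongMemoryTrawl a a' κ c) (t : ℝ) :
    MeasurableSet (trawlSetAt a t) := by
  -- Nothing is known about `a` on negative arguments. Clipping at 0 gives a continuous function
  -- that agrees with `a (t - p.1)` wherever `p.1 ≤ t`.
  have hcont : Continuous fun p : ℝ × ℝ => a (max (t - p.1) 0) :=
    ha.continuousOn_apply.comp_continuous (by fun_prop) fun p => Set.mem_Ici.2 (le_max_right _ _)
  have : trawlSetAt a t = {p | p.1 ≤ t ∧ 0 ≤ p.2 ∧ p.2 ≤ a (max (t - p.1) 0)} := by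
    ext p
    rw [mem_trawlSetAt]
    refine and_congr_right fun h => ?_
    rw [max_eq_left (by linarith)]
  rw [this]
  exact ((isClosed_le continuous_fst continuous_const).inter
    ((isClosed_le continuous_const continuous_snd).inter
      (isClosed_le continuous_snd hcont))).measurableSet

lemma injOn (ha : IsLongMemoryTrawl a a' κ c) : Set.InjOn a (Set.Ioi 0) :=
  ha.strictAntiOn.injOn.mono Set.Ioi_subset_Ici_self

lemma ae_mem_Ioo_or (x : ℝ) : ∀ᵐ y : ℝ, y ∈ Set.Icc 0 x → y ∈ Set.Ioo 0 x := by
  have h : ∀ z : ℝ, ∀ᵐ y : ℝ, y ≠ z := fun z => by simp [ae_iff]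
  filter_upwards [h 0, h x] with y h0 h1 hy
  exact ⟨hy.1.lt_of_ne h0.symm, hy.2.lt_of_ne h1⟩

/-- The horizontal section at height `a(s)` has length `s`, so the volume is `∫ s a'(s) ds`, finite
because `κ > 2`. -/
lemma volume_trawlSetAt_lt_top (ha : IsLongMemoryTrawl a a' κ c) (t : ℝ) :
    volume (trawlSetAt a t) < ∞ := by
  have hκ := ha.two_lt
  rw [Measure.volume_eq_prod, Measure.prod_apply_symm (ha.measurableSet_trawlSetAt t)]
  have h1 : ∫⁻ y, volume ((fun x => (x, y)) ⁻¹' trawlSetAt a t) =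
      ∫⁻ y in a '' Set.Ioi 0, volume ((fun x => (x, y)) ⁻¹' trawlSetAt a t) := by
    rw [ha.image_Ioi, ← lintegral_indicator measurableSet_Ioo]
    refine lintegral_congr_ae ?_
    filter_upwards [ae_mem_Ioo_or (a 0)] with y hy
    by_cases h : y ∈ Set.Ioo 0 (a 0)
    · rw [Set.indicator_of_mem h]
    · rw [Set.indicator_of_notMem h]
      convert measure_empty (μ := (volume : Measure ℝ))
      ext r
      simp only [Set.mem_preimage, Set.mem_empty_iff_false, iff_false]
      exact fun hr => h (hy (ha.snd_le_of_mem_trawlSetAt hr))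
  rw [h1, lintegral_image_eq_lintegral_abs_deriv_mul measurableSet_Ioi
    (fun x hx => (ha.hasDerivAt hx).hasDerivWithinAt) ha.injOn]
  have h2 : ∀ s ∈ Set.Ioi (0 : ℝ), ENNReal.ofReal |-a' s| *
      volume ((fun x => (x, a s)) ⁻¹' trawlSetAt a t) = ENNReal.ofReal (s ^ (1 : ℝ) * a' s) := by
    intro s hs
    have hs' : (0 : ℝ) < s := hs
    have : (fun x => (x, a s)) ⁻¹' trawlSetAt a t = Set.Icc (t - s) t := by
      ext r
      simp only [Set.mem_preimage, ha.mem_trawlSetAt_apply hs'.le, Set.mem_Icc]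
      constructor <;> rintro ⟨h1, h2⟩ <;> constructor <;> linarith
    rw [this, Real.volume_Icc, abs_neg, abs_of_pos (ha.pos s hs'.le),
      ← ENNReal.ofReal_mul (ha.pos s hs'.le).le, Real.rpow_one]
    ring_nf
  rw [setLIntegral_congr_fun measurableSet_Ioi h2]
  exact (ha.integrableOn_rpow_mul zero_le_one (by linarith)).lintegral_lt_top

/-- Integration over the plane in the coordinates `(r, y) = (r, a(s))`. -/
lemma integral_eq (ha : IsLongMemoryTrawl a a' κ c) {G : ℝ × ℝ → ℂ} (hG : Integrable G)
    (h0 : ∀ p, p.2 ∉ Set.Icc 0 (a 0) → G p = 0) :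
    ∫ p, G p = ∫ s in Set.Ioi (0 : ℝ), a' s • ∫ r, G (r, a s) := by
  rw [Measure.volume_eq_prod] at hG ⊢
  rw [integral_prod_symm _ hG]
  have h1 : ∫ y, ∫ x, G (x, y) = ∫ y in a '' Set.Ioi 0, ∫ x, G (x, y) := by
    rw [ha.image_Ioi, ← integral_indicator measurableSet_Ioo]
    refine integral_congr_ae ?_
    filter_upwards [ae_mem_Ioo_or (a 0)] with y hy
    by_cases h : y ∈ Set.Ioo 0 (a 0)
    · rw [Set.indicator_of_mem h]
    · rw [Set.indicator_of_notMem h]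
      simp [h0 (_, y) fun h' => h (hy h')]
  rw [h1, integral_image_eq_integral_abs_deriv_smul measurableSet_Ioi
    (fun x hx => (ha.hasDerivAt hx).hasDerivWithinAt) ha.injOn]
  refine setIntegral_congr_fun measurableSet_Ioi fun s hs => ?_
  simp only [abs_neg, abs_of_pos (ha.pos s (le_of_lt hs))]

end IsLongMemoryTrawl

end TrawlFunction

end TrawlLimit

namespace TrawlLimit

/-! ### Counting the grid points in an interval -/

section GridCount

/-- The number of `k < m` with `kδ ∈ [r, r + s]`. -/
noncomputable def gridCount (δ : ℝ) (m : ℕ) (r s : ℝ) : ℝ :=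
  ∑ k ∈ Finset.range m, if r ≤ δ * k ∧ δ * k ≤ r + s then 1 else 0

/-- The length of `[r, r + s] ∩ [0, u]`. -/
noncomputable def overlap (u r s : ℝ) : ℝ := max (min (r + s) u - max r 0) 0

lemma gridCount_nonneg (δ : ℝ) (m : ℕ) (r s : ℝ) : 0 ≤ gridCount δ m r s :=
  Finset.sum_nonneg fun _ _ => by split_ifs <;> simp

lemma gridCount_le (δ : ℝ) (m : ℕ) (r s : ℝ) : gridCount δ m r s ≤ m := by
  calc gridCount δ m r s ≤ ∑ _k ∈ Finset.range m, (1 : ℝ) :=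
        Finset.sum_le_sum fun _ _ => by split_ifs <;> simp
    _ = m := by simp

lemma gridCount_mono (δ r s : ℝ) {m m' : ℕ} (h : m ≤ m') :
    gridCount δ m r s ≤ gridCount δ m' r s :=
  Finset.sum_le_sum_of_subset_of_nonneg (Finset.range_mono h)
    fun _ _ _ => by split_ifs <;> simp

lemma gridCount_eq_zero {δ : ℝ} (hδ : 0 ≤ δ) {m : ℕ} {r s : ℝ} (h : r + s < 0 ∨ δ * m < r) :
    gridCount δ m r s = 0 := by
  refine Finset.sum_eq_zero fun k hk => if_neg ?_
  rintro ⟨h1, h2⟩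
  have hk' : (k : ℝ) ≤ m := by exact_mod_cast (Finset.mem_range.1 hk).le
  rcases h with h | h
  · have : 0 ≤ δ * k := by positivity
    linarith
  · have : δ * k ≤ δ * m := by gcongr
    linarith

lemma gridCount_mul {T : ℝ} (hT : 0 < T) (δ : ℝ) (m : ℕ) (r s : ℝ) :
    gridCount (T * δ) m (T * r) (T * s) = gridCount δ m r s := by
  unfold gridCount
  refine Finset.sum_congr rfl fun k _ => ?_
  have h1 : T * r ≤ T * δ * k ↔ r ≤ δ * k := by
    rw [mul_assoc, mul_le_mul_iff_right₀ hT]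
  have h2 : T * δ * k ≤ T * r + T * s ↔ δ * k ≤ r + s := by
    rw [mul_assoc, ← mul_add, mul_le_mul_iff_right₀ hT]
  simp only [h1, h2]

lemma gridCount_eq_indicator (δ : ℝ) (m : ℕ) (s : ℝ) : (fun r => gridCount δ m r s) =
    fun r => ∑ k ∈ Finset.range m, (Set.Icc (δ * k - s) (δ * k)).indicator (fun _ => (1 : ℝ)) r := by
  ext r
  refine Finset.sum_congr rfl fun k _ => ?_
  simp only [Set.indicator_apply, Set.mem_Icc]
  congr 1
  rw [and_comm, sub_le_iff_le_add]

lemma integrable_gridCount (δ : ℝ) (m : ℕ) (s : ℝ) : Integrable fun r => gridCount δ m r s := by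
  rw [gridCount_eq_indicator]
  exact integrable_finsetSum _ fun k _ =>
    (integrable_indicator_iff measurableSet_Icc).2 (integrableOn_const (by simp))

/-- The starting points `r` whose segment contains `kδ` fill `[kδ - s, kδ]`, of length `s`, for each
of the `m` values of `k`. The value does not depend on the mesh. -/
lemma integral_gridCount (δ : ℝ) (m : ℕ) {s : ℝ} (hs : 0 ≤ s) :
    ∫ r, gridCount δ m r s = m * s := by
  rw [gridCount_eq_indicator, integral_finsetSum _ fun k _ =>
    (integrable_indicator_iff measurableSet_Icc).2 (integrableOn_const (by simp))]
  simp [integral_indicator measurableSet_Icc, hs]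

lemma overlap_nonneg (u r s : ℝ) : 0 ≤ overlap u r s := le_max_right _ _

lemma overlap_le {s : ℝ} (hs : 0 ≤ s) (u r : ℝ) : overlap u r s ≤ s :=
  max_le (by linarith [min_le_left (r + s) u, le_max_left r 0]) hs

/-- After division by `δ`, rounding each end of the segment to the grid changes its length by at
most one, hence the two units of `δ`. -/
lemma abs_mul_gridCount_sub_overlap_le {δ : ℝ} (hδ : 0 < δ) (m : ℕ) (r s : ℝ) :
    |δ * gridCount δ m r s - overlap (δ * m) r s| ≤ 2 * δ := by
  -- Negative right ends are treated apart: `⌊·⌋₊` sends them to 0, which would wrongly put `k = 0`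
  -- below `r + s`.
  rcases lt_or_ge (r + s) 0 with h | h
  · rw [gridCount_eq_zero hδ.le (Or.inl h), overlap, max_eq_right]
    · simp [hδ.le]
    · linarith [min_le_left (r + s) (δ * m), le_max_right r 0]
  set p := ⌈r / δ⌉₊ with hp
  set q := ⌊(r + s) / δ⌋₊ with hq
  -- The admissible `k` form `Ico p (min m (q + 1))`; truncated subtraction handles the case where
  -- it is empty.
  have hcount : gridCount δ m r s = ((min m (q + 1) - p : ℕ) : ℝ) := by
    have h1 : gridCount δ m r s =
        ∑ k ∈ Finset.range m, if k ∈ Finset.Ico p (q + 1) then (1 : ℝ) else 0 := by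
      refine Finset.sum_congr rfl fun k _ => ?_
      have e1 : r ≤ δ * k ↔ p ≤ k := by
        rw [hp, Nat.ceil_le, div_le_iff₀ hδ, mul_comm]
      have e2 : δ * k ≤ r + s ↔ k < q + 1 := by
        rw [Nat.lt_succ_iff, hq, Nat.le_floor_iff (by positivity), le_div_iff₀ hδ, mul_comm]
      simp only [e1, e2, Finset.mem_Ico]
    rw [h1, ← Finset.sum_filter, Finset.sum_const, nsmul_eq_mul, mul_one]
    congr 1
    rw [← Nat.card_Ico]
    congr 1
    ext k
    simp only [Finset.mem_filter, Finset.mem_range, Finset.mem_Ico]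
    omega
  have hp1 : max (r / δ) 0 ≤ p := max_le (Nat.le_ceil _) (Nat.cast_nonneg _)
  have hp2 : (p : ℝ) < max (r / δ) 0 + 1 := by
    rcases le_total r 0 with hr | hr
    · have : p = 0 := Nat.ceil_eq_zero.2 (div_nonpos_of_nonpos_of_nonneg hr hδ.le)
      rw [this]
      have := le_max_right (r / δ) 0
      push_cast; linarith
    · exact (Nat.ceil_lt_add_one (div_nonneg hr hδ.le)).trans_le (by gcongr; exact le_max_left _ _)
  have hq1 : (q : ℝ) ≤ (r + s) / δ := Nat.floor_le (by positivity)
  have hq2 : (r + s) / δ < q + 1 := Nat.lt_floor_add_one _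
  have hov : overlap (δ * m) r s = δ * max (min ((r + s) / δ) m - max (r / δ) 0) 0 := by
    rw [overlap, mul_max_of_nonneg _ _ hδ.le, mul_sub, mul_min_of_nonneg _ _ hδ.le,
      mul_max_of_nonneg _ _ hδ.le, mul_div_cancel₀ _ hδ.ne', mul_div_cancel₀ _ hδ.ne', mul_zero]
  have hcast : ((min m (q + 1) - p : ℕ) : ℝ) = max (min (m : ℝ) (q + 1) - p) 0 := by
    rcases le_total p (min m (q + 1)) with h | h
    · rw [Nat.cast_sub h, max_eq_left]
      · push_cast; rfl
      · rw [sub_nonneg]; exact_mod_cast h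
    · rw [Nat.sub_eq_zero_of_le h, max_eq_right]
      · simp
      · rw [sub_nonpos]; exact_mod_cast h
  rw [hov, hcount, hcast, ← mul_sub, abs_mul, abs_of_pos hδ, mul_comm]
  gcongr
  refine (abs_max_sub_max_le_abs _ _ _).trans ?_
  set x := (r + s) / δ
  set y := max (r / δ) 0
  have h3 : min (m : ℝ) (q + 1) ≤ min x m + 1 := by
    rw [min_comm x, ← min_add_add_right]
    exact min_le_min (by linarith) (by linarith)
  have h4 : min x m ≤ min (m : ℝ) (q + 1) := by
    rw [min_comm x]
    exact min_le_min le_rfl hq2.le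
  rw [abs_le]
  constructor <;> linarith

lemma mul_gridCount_le {δ : ℝ} (hδ : 0 < δ) (m : ℕ) (r : ℝ) {s : ℝ} (hs : 0 ≤ s) :
    δ * gridCount δ m r s ≤ s + 2 * δ := by
  have h1 := (abs_le.1 (abs_mul_gridCount_sub_overlap_le hδ m r s)).2
  have h2 := overlap_le hs (δ * m) r
  linarith

end GridCount

end TrawlLimit

namespace TrawlLimit

/-! ### Limits of integrals of the exponent along grid counts -/

section GridLimit

variable {ι : Type*} [Fintype ι] {β : ℝ} {ψ : ℝ → ℂ}

/-- The combination `∑ θ_j δ N_j` of scaled grid counts. -/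
noncomputable def gridSum (θ : ι → ℝ) (δ : ℝ) (m : ι → ℕ) (r s : ℝ) : ℝ :=
  ∑ j, θ j * (δ * gridCount δ (m j) r s)

lemma abs_gridSum_le (θ : ι → ℝ) {δ : ℝ} (hδ : 0 < δ) {m : ι → ℕ} {M : ℕ} (hM : ∀ j, m j ≤ M)
    (r s : ℝ) : |gridSum θ δ m r s| ≤ (∑ j, |θ j|) * (δ * gridCount δ M r s) := by
  rw [Finset.sum_mul]
  refine (Finset.abs_sum_le_sum_abs _ _).trans (Finset.sum_le_sum fun j _ => ?_)
  have h0 := gridCount_nonneg δ (m j) r s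
  rw [abs_mul, abs_of_nonneg (by positivity : 0 ≤ δ * gridCount δ (m j) r s)]
  gcongr
  exact gridCount_mono δ r s (hM j)

lemma measurable_gridCount_prod (δ T : ℝ) (m : ℕ) :
    Measurable fun p : ℝ × ℝ => gridCount δ m (T * p.2) p.1 := by
  unfold gridCount
  refine Finset.measurable_fun_sum _ fun k _ => Measurable.ite ?_ measurable_const measurable_const
  have h1 : MeasurableSet {p : ℝ × ℝ | T * p.2 ≤ δ * k} :=
    measurableSet_le (by fun_prop) (by fun_prop)
  have h2 : MeasurableSet {p : ℝ × ℝ | δ * k ≤ T * p.2 + p.1} :=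
    measurableSet_le (by fun_prop) (by fun_prop)
  exact h1.inter h2

lemma measurable_gridSum_prod (θ : ι → ℝ) (δ T : ℝ) (m : ι → ℕ) :
    Measurable fun p : ℝ × ℝ => gridSum θ δ m (T * p.2) p.1 :=
  Finset.measurable_fun_sum _ fun j _ =>
    ((measurable_gridCount_prod δ T (m j)).const_mul δ).const_mul (θ j)

lemma measurable_gridSum (θ : ι → ℝ) (δ T : ℝ) (m : ι → ℕ) (s : ℝ) :
    Measurable fun x : ℝ => gridSum θ δ m (T * x) s :=
  Measurable.comp (g := fun p : ℝ × ℝ => gridSum θ δ m (T * p.2) p.1) (f := fun x => (s, x))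
    (measurable_gridSum_prod θ δ T m) (by fun_prop)

lemma stronglyMeasurable_integral_gridSum (hψ : Continuous ψ) (θ : ι → ℝ) (δ T : ℝ) (m : ι → ℕ) :
    StronglyMeasurable fun s : ℝ => ∫ x, ψ (gridSum θ δ m (T * x) s) :=
  StronglyMeasurable.integral_prod_right'
    (f := fun p : ℝ × ℝ => ψ (gridSum θ δ m (T * p.2) p.1))
    (hψ.measurable.comp (measurable_gridSum_prod θ δ T m)).stronglyMeasurable

/-- Writing `v^β = v^{β-1} v` and bounding only the first factor leaves an estimate linear in the
count, whose integral is known exactly. -/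
lemma norm_gridSum_le (hβ : 1 < β) {C : ℝ} (hC : 0 ≤ C) (hψ : ∀ z, ‖ψ z‖ ≤ C * |z| ^ β)
    (θ : ι → ℝ) {δ : ℝ} (hδ : 0 < δ) {m : ι → ℕ} {M : ℕ} (hM : ∀ j, m j ≤ M) {r s B : ℝ}
    (hB : δ * gridCount δ M r s ≤ B) :
    ‖ψ (gridSum θ δ m r s)‖ ≤
      C * (∑ j, |θ j|) ^ β * B ^ (β - 1) * (δ * gridCount δ M r s) := by
  set v := δ * gridCount δ M r s with hv
  have hv0 : 0 ≤ v := mul_nonneg hδ.le (gridCount_nonneg _ _ _ _)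
  have hΘ : 0 ≤ ∑ j, |θ j| := Finset.sum_nonneg fun _ _ => abs_nonneg _
  have hvv : v ^ β ≤ B ^ (β - 1) * v := by
    rcases hv0.eq_or_lt with h | h
    · rw [← h, Real.zero_rpow (by linarith), mul_zero]
    · have h3 : v ^ β = v ^ (β - 1) * v := by
        rw [← Real.rpow_add_one h.ne', sub_add_cancel]
      rw [h3]
      refine mul_le_mul_of_nonneg_right ?_ hv0
      exact Real.rpow_le_rpow hv0 hB (by linarith)
  calc ‖ψ (gridSum θ δ m r s)‖ ≤ C * |gridSum θ δ m r s| ^ β := hψ _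
    _ ≤ C * ((∑ j, |θ j|) * v) ^ β := by
        gcongr
        exact abs_gridSum_le θ hδ hM r s
    _ = C * (∑ j, |θ j|) ^ β * v ^ β := by rw [Real.mul_rpow hΘ hv0]; ring
    _ ≤ C * (∑ j, |θ j|) ^ β * (B ^ (β - 1) * v) := by gcongr
    _ = _ := by ring

/-- The free parameter `B` is a uniform bound for the scaled count. It is taken as `s + 2δ` when the
segment length is the constraint, and as 1 when the unit window is. -/
lemma norm_integral_gridSum_le (hβ : 1 < β) {C : ℝ} (hC : 0 ≤ C) (hψ : ∀ z, ‖ψ z‖ ≤ C * |z| ^ β)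
    (θ : ι → ℝ) {δ : ℝ} (hδ : 0 < δ) {m : ι → ℕ} {M : ℕ} (hM : ∀ j, m j ≤ M) {T : ℝ} (hT : 0 < T)
    {s B : ℝ} (hs : 0 ≤ s) (hB : ∀ r, δ * gridCount δ M r s ≤ B) :
    ‖∫ x, ψ (gridSum θ δ m (T * x) s)‖ ≤
      C * (∑ j, |θ j|) ^ β * B ^ (β - 1) * (δ * M / T * s) := by
  have hint : Integrable fun x => gridCount δ M (T * x) s :=
    (integrable_gridCount δ M s).comp_mul_left' hT.ne'
  have h1 : ∫ x, δ * gridCount δ M (T * x) s = δ * M / T * s := by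
    rw [integral_const_mul, Measure.integral_comp_mul_left (fun r => gridCount δ M r s),
      integral_gridCount δ M hs, abs_of_pos (inv_pos.2 hT), smul_eq_mul]
    field_simp
  rw [← h1, ← integral_const_mul]
  refine norm_integral_le_of_norm_le ((hint.const_mul _).const_mul _) (ae_of_all _ fun x => ?_)
  exact norm_gridSum_le hβ hC hψ θ hδ hM (hB _)

/-- The count vanishes unless `[T x, T x + s]` meets `[0, δM]`. As `T ≥ 1`, this confines `x` to a
bounded interval independent of `T`, which supplies the dominating function for the inner limit. -/
lemma norm_gridSum_le_indicator (hβ : 1 < β) {C : ℝ} (hC : 0 ≤ C)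
    (hψ : ∀ z, ‖ψ z‖ ≤ C * |z| ^ β) (θ : ι → ℝ) {δ : ℝ} (hδ : 0 < δ) (hδ1 : δ ≤ 1)
    {m : ι → ℕ} {M : ℕ} (hM : ∀ j, m j ≤ M) {T τ : ℝ} (hT : 1 ≤ T) (hMT : δ * M ≤ T * τ)
    (x : ℝ) {s : ℝ} (hs : 0 ≤ s) :
    ‖ψ (gridSum θ δ m (T * x) s)‖ ≤ (Set.Icc (-s) τ).indicator
      (fun _ => C * (∑ j, |θ j|) ^ β * (s + 2) ^ (β - 1) * (s + 2)) x := by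
  have h := norm_gridSum_le hβ hC hψ θ hδ hM (mul_gridCount_le hδ M (T * x) hs)
  have hΘ : 0 ≤ ∑ j, |θ j| := Finset.sum_nonneg fun _ _ => abs_nonneg _
  by_cases hx : x ∈ Set.Icc (-s) τ
  · rw [Set.indicator_of_mem hx]
    have h2 := mul_gridCount_le hδ M (T * x) hs
    have h3 := gridCount_nonneg δ M (T * x) s
    refine h.trans ?_
    gcongr
    · linarith
    · linarith
  · rw [Set.indicator_of_notMem hx]
    rw [gridCount_eq_zero hδ.le, mul_zero, mul_zero] at h
    · exact h
    · rw [Set.mem_Icc, not_and_or, not_le, not_le] at hx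
      rcases hx with hx | hx
      · left
        nlinarith
      · right
        exact hMT.trans_lt (by gcongr)

/-- Convergence of `∫ ψ(∑ θ_j δ N_j)` when the lengths approximated by the grid counts converge. -/
lemma tendsto_integral_gridSum (hβ : 1 < β) (hψ : IsHomogeneousExponent β ψ) (θ : ι → ℝ)
    {δ T : ℕ → ℝ} {m : ι → ℕ → ℕ} {M : ℕ → ℕ} {τ : ℝ} (hδ : ∀ᶠ n in atTop, 0 < δ n)
    (hδ0 : Tendsto δ atTop (𝓝 0)) (hT : ∀ᶠ n in atTop, 1 ≤ T n)
    (hM : ∀ n j, m j n ≤ M n) (hMT : ∀ᶠ n in atTop, δ n * M n ≤ T n * τ) {s : ℝ} (hs : 0 ≤ s)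
    {o : ι → ℝ → ℝ} (ho : ∀ᵐ x, ∀ j,
      Tendsto (fun n => overlap (δ n * m j n) (T n * x) s) atTop (𝓝 (o j x))) :
    Tendsto (fun n => ∫ x, ψ (gridSum θ (δ n) (fun j => m j n) (T n * x) s)) atTop
      (𝓝 (∫ x, ψ (∑ j, θ j * o j x))) := by
  obtain ⟨C, hC, hb⟩ := hψ.bound
  have hδ1 : ∀ᶠ n in atTop, δ n ≤ 1 := (hδ0.eventually_lt_const one_pos).mono fun _ h => h.le
  refine tendsto_integral_filter_of_dominated_convergence
    ((Set.Icc (-s) τ).indicator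
      (fun _ => C * (∑ j, |θ j|) ^ β * (s + 2) ^ (β - 1) * (s + 2))) ?_ ?_ ?_ ?_
  · exact Eventually.of_forall fun n =>
      (hψ.continuous.measurable.comp (measurable_gridSum θ _ _ _ s)).aestronglyMeasurable
  · filter_upwards [hδ, hδ1, hT, hMT] with n h1 h2 h3 h4
    exact ae_of_all _ fun x => norm_gridSum_le_indicator hβ hC hb θ h1 h2 (hM n) h3 h4 x hs
  · exact (integrable_indicator_iff measurableSet_Icc).2 (integrableOn_const (by simp))
  · filter_upwards [ho] with x hx
    refine (hψ.continuous.tendsto _).comp (tendsto_finsetSum _ fun j _ => Tendsto.const_mul _ ?_)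
    have h0 : Tendsto (fun n => δ n * gridCount (δ n) (m j n) (T n * x) s -
        overlap (δ n * m j n) (T n * x) s) atTop (𝓝 0) := by
      have h5 : Tendsto (fun n => 2 * δ n) atTop (𝓝 0) := by simpa using hδ0.const_mul 2
      refine squeeze_zero_norm' ?_ h5
      filter_upwards [hδ] with n hn
      exact abs_mul_gridCount_sub_overlap_le hn _ _ _
    simpa using h0.add (hx j)

/-- On the scale `T → ∞` a segment of fixed length shrinks to a point: eventually it lies inside the
window if `0 < x < t`, and otherwise contributes no overlap. The sequence is eventually equal to its
limit. -/
lemma tendsto_overlap {δ T : ℕ → ℝ} {m : ℕ → ℕ} {t : ℝ}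
    (hδ0 : Tendsto δ atTop (𝓝 0)) (hT : Tendsto T atTop atTop)
    (hm1 : ∀ᶠ n in atTop, δ n * m n ≤ T n * t)
    (hm2 : ∀ᶠ n in atTop, T n * t - δ n ≤ δ n * m n) {s : ℝ} (hs : 0 ≤ s) {x : ℝ} (hx0 : x ≠ 0)
    (hxt : x ≠ t) :
    Tendsto (fun n => overlap (δ n * m n) (T n * x) s) atTop
      (𝓝 (s * (Set.Ioo 0 t).indicator (fun _ => (1 : ℝ)) x)) := by
  have hδ1 : ∀ᶠ n in atTop, δ n ≤ 1 := (hδ0.eventually_lt_const one_pos).mono fun _ h => h.le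
  refine tendsto_const_nhds.congr' ?_
  rcases hx0.lt_or_gt with hx0 | hx0
  · filter_upwards [(hT.atTop_mul_const (neg_pos.2 hx0)).eventually_ge_atTop s] with n hn
    rw [Set.indicator_of_notMem (fun h => (lt_asymm hx0 h.1)), mul_zero, overlap, max_eq_right]
    have h1 := min_le_left (T n * x + s) (δ n * m n)
    have h2 := le_max_right (T n * x) 0
    linarith
  rcases hxt.lt_or_gt with hxt | hxt
  · filter_upwards [(hT.atTop_mul_const (sub_pos.2 hxt)).eventually_ge_atTop (s + 1), hδ1, hm2,
      hT.eventually_ge_atTop 0] with n hn h1 h2 h3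
    have h4 : 0 ≤ T n * x := mul_nonneg h3 hx0.le
    rw [Set.indicator_of_mem (Set.mem_Ioo.2 ⟨hx0, hxt⟩), mul_one, overlap, max_eq_left h4,
      min_eq_left (by linarith), max_eq_left (by linarith)]
    ring
  · filter_upwards [hm1, hT.eventually_ge_atTop 0] with n h1 h2
    rw [Set.indicator_of_notMem (fun h => (lt_asymm hxt h.2)), mul_zero, overlap, max_eq_right]
    have h3 := min_le_right (T n * x + s) (δ n * m n)
    have h4 := le_max_left (T n * x) 0
    have h5 : T n * t ≤ T n * x := by gcongr
    linarith

lemma ae_ne_and_ne (t : ι → ℝ) : ∀ᵐ x : ℝ, x ≠ 0 ∧ ∀ j, x ≠ t j := by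
  have h : ∀ z : ℝ, ∀ᵐ y : ℝ, y ≠ z := fun z => by simp [ae_iff]
  exact (h 0).and (ae_all_iff.2 fun j => h (t j))

/-- The limit of the exponents of the finite-dimensional distributions in the regime
`1 < β < κ - 1`. -/
lemma tendsto_integral_shortScale {a a' : ℝ → ℝ} {κ c : ℝ} (ha : IsLongMemoryTrawl a a' κ c)
    (hβ : 1 < β) (hβκ : β < κ - 1) (hψ : IsHomogeneousExponent β ψ) (θ t : ι → ℝ)
    {Δ : ℕ → ℝ} (hΔ : ∀ n, 0 ≤ Δ n) (hΔ0 : Tendsto Δ atTop (𝓝 0))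
    (hΔT : Tendsto (fun n : ℕ => (n : ℝ) * Δ n) atTop atTop) {m : ι → ℕ → ℕ}
    (hm1 : ∀ n j, (m j n : ℝ) ≤ n * t j) (hm2 : ∀ n j, n * t j ≤ m j n + 1) :
    Tendsto (fun n : ℕ => ∫ s in Set.Ioi (0 : ℝ), a' s •
        ∫ x, ψ (gridSum θ (Δ n) (fun j => m j n) ((n : ℝ) * Δ n * x) s)) atTop
      (𝓝 (shortScale a' β *
        ∫ x, ψ (∑ j, θ j * (Set.Ioo 0 (t j)).indicator (fun _ => (1 : ℝ)) x))) := by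
  obtain ⟨C, hC, hb⟩ := hψ.bound
  set T : ℕ → ℝ := fun n => (n : ℝ) * Δ n with hT
  have hΔpos : ∀ᶠ n in atTop, 0 < Δ n := by
    filter_upwards [hΔT.eventually_gt_atTop 0] with n hn
    exact (hΔ n).lt_of_ne fun h => by rw [hT] at hn; simp [← h] at hn
  have hΔ1 : ∀ᶠ n in atTop, Δ n ≤ 1 := (hΔ0.eventually_lt_const one_pos).mono fun _ h => h.le
  have hT1 : ∀ᶠ n in atTop, 1 ≤ T n := hΔT.eventually_ge_atTop 1
  -- The sums over `j` serve as crude common bounds for all `m j n` and all `t j`.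
  set M : ℕ → ℕ := fun n => ∑ j, m j n with hMdef
  set τ : ℝ := ∑ j, t j with hτ
  have hM : ∀ n j, m j n ≤ M n := fun n j =>
    Finset.single_le_sum (f := fun j => m j n) (fun _ _ => Nat.zero_le _) (Finset.mem_univ j)
  have hMT : ∀ n, Δ n * M n ≤ T n * τ := by
    intro n
    have h1 : (M n : ℝ) ≤ n * τ := by
      rw [hMdef, hτ, Finset.mul_sum]
      push_cast
      exact Finset.sum_le_sum fun j _ => hm1 n j
    calc Δ n * M n ≤ Δ n * (n * τ) := mul_le_mul_of_nonneg_left h1 (hΔ n)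
      _ = T n * τ := by rw [hT]; ring
  have hinner : ∀ s ∈ Set.Ioi (0 : ℝ), Tendsto
      (fun n => ∫ x, ψ (gridSum θ (Δ n) (fun j => m j n) (T n * x) s)) atTop
      (𝓝 (∫ x, ψ (∑ j, θ j * (s * (Set.Ioo 0 (t j)).indicator (fun _ => (1 : ℝ)) x)))) := by
    intro s hs
    refine tendsto_integral_gridSum hβ hψ θ hΔpos hΔ0 hT1 hM (Eventually.of_forall hMT)
      (le_of_lt hs) ?_
    filter_upwards [ae_ne_and_ne t] with x hx j
    refine tendsto_overlap hΔ0 hΔT (Eventually.of_forall fun n => ?_)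
      (Eventually.of_forall fun n => ?_) (le_of_lt hs) hx.1 (hx.2 j)
    · calc Δ n * m j n ≤ Δ n * (n * t j) := mul_le_mul_of_nonneg_left (hm1 n j) (hΔ n)
        _ = n * Δ n * t j := by ring
    · have := mul_le_mul_of_nonneg_left (hm2 n j) (hΔ n)
      calc n * Δ n * t j - Δ n = Δ n * (n * t j) - Δ n := by ring
        _ ≤ Δ n * (m j n + 1) - Δ n := by linarith
        _ = _ := by ring
  have hlim : shortScale a' β *
        ∫ x, ψ (∑ j, θ j * (Set.Ioo 0 (t j)).indicator (fun _ => (1 : ℝ)) x) =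
      ∫ s in Set.Ioi (0 : ℝ), a' s •
        ∫ x, ψ (∑ j, θ j * (s * (Set.Ioo 0 (t j)).indicator (fun _ => (1 : ℝ)) x)) := by
    rw [shortScale, ← integral_complex_ofReal, ← integral_mul_const]
    refine setIntegral_congr_fun measurableSet_Ioi fun s hs => ?_
    have h1 : ∀ x, ψ (∑ j, θ j * (s * (Set.Ioo 0 (t j)).indicator (fun _ => (1 : ℝ)) x)) =
        (s ^ β : ℝ) * ψ (∑ j, θ j * (Set.Ioo 0 (t j)).indicator (fun _ => (1 : ℝ)) x) := by
      intro x
      rw [← hψ.map_mul s (le_of_lt hs), Finset.mul_sum]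
      congr 1
      exact Finset.sum_congr rfl fun j _ => by ring
    simp only [h1, integral_const_mul, Complex.real_smul]
    push_cast
    ring
  rw [hlim]
  set D := C * (∑ j, |θ j|) ^ β with hD
  have hΘ : 0 ≤ ∑ j, |θ j| := Finset.sum_nonneg fun _ _ => abs_nonneg _
  have hD0 : 0 ≤ D := by positivity
  have hτ0 : 0 ≤ τ := by
    refine Finset.sum_nonneg fun j _ => ?_
    -- The case `n = 1` already forces `t j ≥ 0`.
    have := hm1 1 j
    have h2 : (0 : ℝ) ≤ m j 1 := Nat.cast_nonneg _
    push_cast at this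
    linarith
  -- The inner integral is `O(1 + s^β)` uniformly in `n`, and `β < κ - 1` makes this integrable
  -- against `a'`.
  refine tendsto_integral_filter_of_dominated_convergence
    (fun s => D * τ * 3 ^ β * (s ^ (0 : ℝ) * a' s + s ^ β * a' s)) ?_ ?_ ?_ ?_
  · exact Eventually.of_forall fun n => ha.aestronglyMeasurable.smul
      (stronglyMeasurable_integral_gridSum hψ.continuous θ _ _ _).aestronglyMeasurable
  · filter_upwards [hΔpos, hΔ1, hT1] with n h1 h2 h3
    filter_upwards [ae_restrict_mem measurableSet_Ioi] with s hs
    have hs0 : (0 : ℝ) < s := hs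
    have hT0 : 0 < T n := by linarith
    have h4 := norm_integral_gridSum_le hβ hC hb θ h1 (hM n) hT0 hs0.le
      (fun r => mul_gridCount_le h1 (M n) r hs0.le)
    have h5 := (ha.pos s hs0.le).le
    have h6 : Δ n * M n / T n ≤ τ := by
      rw [div_le_iff₀ hT0, mul_comm τ]; exact hMT n
    have h7 : (s + 2 * Δ n) ^ (β - 1) * s ≤ 3 ^ β * (1 + s ^ β) := by
      calc (s + 2 * Δ n) ^ (β - 1) * s ≤ (s + 2) ^ (β - 1) * (s + 2) := by
            gcongr <;> linarith
        _ = (s + 2) ^ β := by rw [← Real.rpow_add_one (by linarith), sub_add_cancel]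
        _ ≤ (3 * max 1 s) ^ β := by
            gcongr
            linarith [le_max_left 1 s, le_max_right 1 s]
        _ = 3 ^ β * (max 1 s) ^ β := Real.mul_rpow (by norm_num) (by positivity)
        _ ≤ 3 ^ β * (1 + s ^ β) := by
            gcongr
            rcases max_cases 1 s with h | h
            · rw [h.1, Real.one_rpow]; linarith [Real.rpow_nonneg hs0.le β]
            · rw [h.1]; linarith
    rw [norm_smul, Real.norm_of_nonneg h5, Real.rpow_zero]
    calc a' s * _ ≤ a' s * (D * (s + 2 * Δ n) ^ (β - 1) * (Δ n * M n / T n * s)) := by gcongr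
      _ ≤ a' s * (D * (s + 2 * Δ n) ^ (β - 1) * (τ * s)) := by gcongr
      _ = a' s * (D * τ) * ((s + 2 * Δ n) ^ (β - 1) * s) := by ring
      _ ≤ a' s * (D * τ) * (3 ^ β * (1 + s ^ β)) := by gcongr
      _ = _ := by ring
  · exact ((ha.integrableOn_rpow_mul le_rfl (by linarith)).add
      (ha.integrableOn_rpow_mul (by linarith) hβκ)).const_mul _
  · filter_upwards [ae_restrict_mem measurableSet_Ioi] with s hs
    exact (hinner s hs).const_smul _

end GridLimit

end TrawlLimit

namespace TrawlLimit

/-! ### The long memory regime -/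

section LongScale

lemma continuous_overlap (u s : ℝ) : Continuous fun x => overlap u x s := by
  unfold overlap; fun_prop

/-- As a function of `x` the overlap is a trapezoid: it rises with slope 1 to the height `min σ 1`,
stays there on a plateau of length `|1 - σ|`, and falls with slope 1. -/
lemma integral_overlap_rpow {β σ : ℝ} (hβ : 0 < β) (hσ : 0 < σ) :
    ∫ x, overlap 1 x σ ^ β =
      2 * (min σ 1 ^ (β + 1) / (β + 1)) + |1 - σ| * min σ 1 ^ β := by
  set μ := min σ 1 with hμ
  have hμσ : μ ≤ σ := min_le_left _ _
  have hμ1 : μ ≤ 1 := min_le_right _ _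
  have hμ0 : 0 < μ := lt_min hσ one_pos
  have hμc : (μ = σ ∧ σ ≤ 1) ∨ (μ = 1 ∧ 1 ≤ σ) := by
    rcases le_total σ 1 with h | h
    · exact Or.inl ⟨min_eq_left h, h⟩
    · exact Or.inr ⟨min_eq_right h, h⟩
  have hmid : -σ + μ ≤ 1 - μ := by
    rcases hμc with h | h <;> linarith [h.1, h.2]
  have habs : |1 - σ| = (1 - μ) - (-σ + μ) := by
    rcases hμc with h | h
    · rw [abs_of_nonneg (by linarith [h.2]), h.1]; ring
    · rw [abs_of_nonpos (by linarith [h.2]), h.1]; ring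
  have hzero : ∀ x, x ∉ Set.Ioc (-σ) 1 → overlap 1 x σ ^ β = 0 := by
    intro x hx
    have : overlap 1 x σ = 0 := by
      rw [overlap, max_eq_right]
      rw [Set.mem_Ioc, not_and_or, not_lt, not_le] at hx
      rcases hx with hx | hx
      · linarith [min_le_left (x + σ) 1, le_max_right x 0]
      · linarith [min_le_right (x + σ) 1, le_max_left x 0]
    rw [this, Real.zero_rpow hβ.ne']
  have hcont : Continuous fun x => overlap 1 x σ ^ β :=
    (continuous_overlap 1 σ).rpow_const fun _ => Or.inr hβ.le
  have hii : ∀ p q, IntervalIntegrable (fun x => overlap 1 x σ ^ β) volume p q :=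
    fun p q => hcont.intervalIntegrable p q
  rw [← setIntegral_eq_integral_of_forall_compl_eq_zero hzero,
    ← intervalIntegral.integral_of_le (by linarith),
    ← intervalIntegral.integral_add_adjacent_intervals (hii (-σ) (1 - μ)) (hii _ _),
    ← intervalIntegral.integral_add_adjacent_intervals (hii (-σ) (-σ + μ)) (hii _ _)]
  have h1 : ∫ x in -σ..-σ + μ, overlap 1 x σ ^ β = μ ^ (β + 1) / (β + 1) := by
    have : ∫ x in -σ..-σ + μ, overlap 1 x σ ^ β = ∫ x in -σ..-σ + μ, (x + σ) ^ β := by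
      refine intervalIntegral.integral_congr fun x hx => ?_
      rw [Set.uIcc_of_le (by linarith)] at hx
      have hx1 := hx.1
      have hx2 := hx.2
      simp only [overlap]
      rw [max_eq_right (by linarith : x ≤ 0), min_eq_left (by linarith), sub_zero,
        max_eq_left (by linarith)]
    rw [this, intervalIntegral.integral_comp_add_right (fun x => x ^ β) σ,
      integral_rpow (Or.inl (by linarith))]
    rw [show -σ + σ = 0 by ring, show -σ + μ + σ = μ by ring,
      Real.zero_rpow (by linarith : β + 1 ≠ 0), sub_zero]
  have h2 : ∫ x in -σ + μ..1 - μ, overlap 1 x σ ^ β = |1 - σ| * μ ^ β := by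
    have : ∫ x in -σ + μ..1 - μ, overlap 1 x σ ^ β = ∫ x in -σ + μ..1 - μ, μ ^ β := by
      refine intervalIntegral.integral_congr fun x hx => ?_
      rw [Set.uIcc_of_le hmid] at hx
      have hx1 := hx.1
      have hx2 := hx.2
      simp only [overlap]
      congr 1
      rcases hμc with h | h
      · rw [max_eq_left (by linarith [h.1] : 0 ≤ x), min_eq_left (by linarith [h.1]), h.1,
          max_eq_left (by linarith)]
        ring
      · rw [max_eq_right (by linarith [h.1] : x ≤ 0), min_eq_right (by linarith [h.1]), h.1,
          max_eq_left (by linarith)]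
        ring
    rw [this, intervalIntegral.integral_const, habs, smul_eq_mul]
  have h3 : ∫ x in 1 - μ..1, overlap 1 x σ ^ β = μ ^ (β + 1) / (β + 1) := by
    have : ∫ x in 1 - μ..1, overlap 1 x σ ^ β = ∫ x in 1 - μ..1, (1 - x) ^ β := by
      refine intervalIntegral.integral_congr fun x hx => ?_
      rw [Set.uIcc_of_le (by linarith)] at hx
      have hx1 := hx.1
      have hx2 := hx.2
      simp only [overlap]
      rw [max_eq_left (by linarith : 0 ≤ x), min_eq_right (by linarith), max_eq_left (by linarith)]
    rw [this, intervalIntegral.integral_comp_sub_left (fun x => x ^ β) 1,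
      integral_rpow (Or.inl (by linarith))]
    rw [sub_self, sub_sub_cancel, Real.zero_rpow (by linarith : β + 1 ≠ 0), sub_zero]
  rw [h1, h2, h3]
  ring

/-- The integral is split at `σ = 1`. The condition `β > κ - 1` gives integrability of `σ^{β-κ}` at
0, and `κ > 2` that of `σ^{1-κ}` at infinity. The integral of `(1 - s) s^{β-κ}` is common to both
sides; the remaining terms agree after explicit evaluation. -/
lemma integral_longScale {β κ : ℝ} (h2 : 2 < κ) (hβ : κ - 1 < β) :
    ∫ σ in Set.Ioi (0 : ℝ), (κ - 1) * σ ^ (-κ) * ∫ x, overlap 1 x σ ^ β = longScale κ β := by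
  have hβ0 : 0 < β := by linarith
  have e1 : ∀ σ ∈ Set.Ioc (0 : ℝ) 1, (κ - 1) * σ ^ (-κ) * ∫ x, overlap 1 x σ ^ β =
      (κ - 1) * ((1 - σ) * σ ^ (β - κ)) + 2 * (κ - 1) / (β + 1) * σ ^ (β - κ + 1) := by
    intro σ hσ
    have hp : ∀ y, σ ^ (-κ) * σ ^ y = σ ^ (y - κ) := fun y => by
      rw [← Real.rpow_add hσ.1]; ring_nf
    rw [integral_overlap_rpow hβ0 hσ.1, min_eq_left hσ.2, abs_of_nonneg (by linarith [hσ.2]),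
      ← hp β, show β - κ + 1 = (β + 1) - κ by ring, ← hp]
    ring
  have e2 : ∀ σ ∈ Set.Ioi (1 : ℝ), (κ - 1) * σ ^ (-κ) * ∫ x, overlap 1 x σ ^ β =
      (κ - 1) * σ ^ (1 - κ) + (κ - 1) * (2 / (β + 1) - 1) * σ ^ (-κ) := by
    intro σ hσ
    have hσ1 : (1 : ℝ) < σ := hσ
    have hp : σ ^ (1 - κ) = σ ^ (-κ) * σ := by
      rw [← Real.rpow_add_one (by linarith)]; ring_nf
    rw [integral_overlap_rpow hβ0 (by linarith), min_eq_right hσ1.le,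
      abs_of_nonpos (by linarith), hp, Real.one_rpow, Real.one_rpow]
    ring
  have i1 : IntervalIntegrable (fun σ : ℝ => (κ - 1) * ((1 - σ) * σ ^ (β - κ))) volume 0 1 :=
    ((intervalIntegral.intervalIntegrable_rpow' (by linarith)).continuousOn_mul
      (by fun_prop)).const_mul _
  have i2 : IntervalIntegrable (fun σ : ℝ => 2 * (κ - 1) / (β + 1) * σ ^ (β - κ + 1))
      volume 0 1 :=
    (intervalIntegral.intervalIntegrable_rpow' (by linarith)).const_mul _
  have i3 : IntegrableOn (fun σ : ℝ => (κ - 1) * σ ^ (1 - κ)) (Set.Ioi 1) :=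
    (integrableOn_Ioi_rpow_of_lt (by linarith) one_pos).const_mul _
  have i4 : IntegrableOn (fun σ : ℝ => (κ - 1) * (2 / (β + 1) - 1) * σ ^ (-κ)) (Set.Ioi 1) :=
    (integrableOn_Ioi_rpow_of_lt (by linarith) one_pos).const_mul _
  rw [← Set.Ioc_union_Ioi_eq_Ioi (zero_le_one' ℝ), setIntegral_union (Set.Ioc_disjoint_Ioi le_rfl)
    measurableSet_Ioi ((integrableOn_congr_fun e1 measurableSet_Ioc).2
      ((intervalIntegrable_iff_integrableOn_Ioc_of_le zero_le_one).1 (i1.add i2)))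
    ((integrableOn_congr_fun e2 measurableSet_Ioi).2 (i3.add i4)),
    setIntegral_congr_fun measurableSet_Ioc e1, setIntegral_congr_fun measurableSet_Ioi e2,
    integral_add i3 i4, ← intervalIntegral.integral_of_le zero_le_one,
    intervalIntegral.integral_add i1 i2, integral_const_mul, integral_const_mul,
    integral_Ioi_rpow_of_lt (by linarith) one_pos, integral_Ioi_rpow_of_lt (by linarith) one_pos,
    intervalIntegral.integral_const_mul, intervalIntegral.integral_const_mul, longScale,
    integral_rpow (Or.inl (by linarith)), Real.one_rpow, Real.one_rpow, Real.one_rpow,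
    Real.zero_rpow (by linarith : β - κ + 1 + 1 ≠ 0)]
  have n1 : κ - 2 ≠ 0 := by linarith
  have n2 : κ - 1 ≠ 0 := by linarith
  have n3 : β + 1 ≠ 0 := by linarith
  have n4 : β - κ + 1 + 1 ≠ 0 := by linarith
  have n5 : 1 - κ + 1 ≠ 0 := by
    rw [show 1 - κ + 1 = -(κ - 2) by ring]; exact neg_ne_zero.2 n1
  have n6 : -κ + 1 ≠ 0 := by
    rw [show -κ + 1 = -(κ - 1) by ring]; exact neg_ne_zero.2 n2
  rw [show 1 - κ + 1 = -(κ - 2) by ring, show -κ + 1 = -(κ - 1) by ring]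
  field_simp
  ring

lemma longScale_pos {β κ : ℝ} (h2 : 2 < κ) : 0 < longScale κ β := by
  have h1 : 0 < 1 / (κ - 2) := one_div_pos.2 (by linarith)
  have h3 : 0 ≤ ∫ s in (0 : ℝ)..1, (1 - s) * s ^ (β - κ) :=
    intervalIntegral.integral_nonneg zero_le_one fun s hs =>
      mul_nonneg (by linarith [hs.2]) (Real.rpow_nonneg hs.1 _)
  have h4 : 0 ≤ ∫ s in (0 : ℝ)..1, s ^ (β - κ + 1) :=
    intervalIntegral.integral_nonneg zero_le_one fun s hs => Real.rpow_nonneg hs.1 _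
  have h5 : 0 ≤ (κ - 1) * ∫ s in (0 : ℝ)..1, (1 - s) * s ^ (β - κ) :=
    mul_nonneg (by linarith) h3
  unfold longScale
  linarith

variable {a a' : ℝ → ℝ} {κ c β : ℝ} {ψ : ℝ → ℂ}

/-- A Potter-type bound for the rescaled density. -/
lemma IsLongMemoryTrawl.exists_density_le (ha : IsLongMemoryTrawl a a' κ c) :
    ∃ D, 0 < D ∧ ∀ᶠ T in atTop, ∀ p, 0 ≤ p → p ≤ κ → ∀ σ, 0 < σ →
      T * a' (T * σ) / a T ≤ D * (T ^ (κ - p) * σ ^ (-p)) := by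
  obtain ⟨C, hC, -, hCp⟩ := ha.exists_le_rpow
  obtain ⟨E, hE, hO⟩ := ha.equivalent.isBigO_symm.exists_pos
  have hκ := ha.two_lt
  have hc := ha.const_pos
  have h1 := ha.tendsto_density one_pos
  rw [Real.one_rpow, mul_one] at h1
  refine ⟨κ * C * (E / c), by positivity, ?_⟩
  -- The factor `κ` is merely a number above the limit `κ - 1` of `T a'(T) / a(T)`; it bounds `T /
  -- a(T)` by a multiple of `T^κ`.
  filter_upwards [h1.eventually_lt_const (by linarith : κ - 1 < κ), hO.bound,
    eventually_gt_atTop 0] with T hT1 hT2 hT p hp hpκ σ hσ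
  rw [mul_one] at hT1
  have hTk : 0 < T ^ (-κ) := Real.rpow_pos_of_pos hT _
  have ha0 := ha.pos_apply hT.le
  have ha1 := ha.pos T hT.le
  rw [Real.norm_of_nonneg (by positivity), Real.norm_of_nonneg ha1.le] at hT2
  have h3 : T / a T ≤ κ * (E / c) * T ^ κ := by
    rw [div_lt_iff₀ ha0] at hT1
    rw [div_le_iff₀ ha0]
    have h4 : T ^ (-κ) * T ^ κ = 1 := by rw [← Real.rpow_add hT]; simp
    have h5 : T * (c * T ^ (-κ)) ≤ κ * a T * E := by
      calc T * (c * T ^ (-κ)) ≤ T * (E * a' T) := by gcongr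
        _ = E * (T * a' T) := by ring
        _ ≤ E * (κ * a T) := by gcongr
        _ = _ := by ring
    calc T = (T * (c * T ^ (-κ))) * (T ^ κ / c) := by
          field_simp
          rw [h4]
      _ ≤ (κ * a T * E) * (T ^ κ / c) := by gcongr
      _ = _ := by ring
  have h6 := hCp p hp hpκ (T * σ) (by positivity)
  rw [Real.mul_rpow hT.le hσ.le] at h6
  calc T * a' (T * σ) / a T = T / a T * a' (T * σ) := by ring
    _ ≤ (κ * (E / c) * T ^ κ) * (C * (T ^ (-p) * σ ^ (-p))) := by
        gcongr
        exact (ha.pos _ (by positivity)).le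
    _ = _ := by rw [sub_eq_add_neg, Real.rpow_add hT]; ring

lemma aestronglyMeasurable_density (ha : IsLongMemoryTrawl a a' κ c) {T : ℝ} (hT : 0 < T) :
    AEStronglyMeasurable (fun σ => T * a' (T * σ) / a T) (volume.restrict (Set.Ioi 0)) := by
  have h : ContinuousOn (fun σ => T * a' (T * σ) / a T) (Set.Ioi 0) := by
    refine (ContinuousOn.mul continuousOn_const (ha.continuousOn.comp (by fun_prop) ?_)).div_const _
    intro σ hσ
    exact (mul_pos hT hσ).le
  exact h.aestronglyMeasurable measurableSet_Ioi

/-- The integral of the exponent in the coordinates rescaled by `T = nΔ_n`. -/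
lemma integral_rescale (ha : IsLongMemoryTrawl a a' κ c) (hβ : 0 < β)
    (hψ : IsHomogeneousExponent β ψ) (z : ℝ) {n : ℕ} {δ : ℝ} (hT : 0 < (n : ℝ) * δ) :
    ∫ s in Set.Ioi (0 : ℝ), a' s • ∫ r,
        ψ (z * (1 / (n * (a (n * δ) * (n * δ)) ^ (1 / β))) * gridCount δ n r s) =
      ∫ σ in Set.Ioi (0 : ℝ), ((n * δ) * a' ((n * δ) * σ) / a (n * δ)) •
        ∫ x, ψ (gridSum (fun _ : Unit => z) (1 / n) (fun _ => n) (1 * x) σ) := by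
  set T := (n : ℝ) * δ with hTdef
  have hn : (n : ℝ) ≠ 0 := fun h => by simp [hTdef, h] at hT
  have haT := ha.pos_apply hT.le
  -- By homogeneity the normalisation leaves `ψ` as `q`. The substitutions in `r` and in `s`
  -- contribute `T` each, and `T² q = T / a(T)`.
  set q := (a T * T)⁻¹ with hq
  have hq0 : 0 < q := by positivity
  have hpow : ((a T * T) ^ (1 / β))⁻¹ ^ β = q := by
    rw [← Real.inv_rpow (by positivity), ← Real.rpow_mul (by positivity),
      one_div_mul_cancel hβ.ne', Real.rpow_one]
  have h1 : ∀ r s, ψ (z * (1 / (n * (a T * T) ^ (1 / β))) * gridCount δ n r s) =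
      (q : ℂ) * ψ (gridSum (fun _ : Unit => z) (1 / n) (fun _ => n) (1 * (r / T)) (s / T)) := by
    intro r s
    have hg : gridCount δ n r s = gridCount (1 / n) n (r / T) (s / T) := by
      rw [← gridCount_mul hT (1 / n) n (r / T) (s / T), mul_div_cancel₀ _ hT.ne',
        mul_div_cancel₀ _ hT.ne']
      congr 1
      rw [hTdef]; field_simp
    rw [hg, ← hpow, ← hψ.map_mul _ (by positivity)]
    congr 1
    simp only [gridSum, Finset.univ_unique, Finset.sum_const, Finset.card_singleton, one_smul,
      one_mul, one_div, mul_inv]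
    ring
  have h2 : ∀ s, ∫ r, ψ (z * (1 / (n * (a T * T) ^ (1 / β))) * gridCount δ n r s) =
      (q : ℂ) * (T • ∫ x, ψ (gridSum (fun _ : Unit => z) (1 / n) (fun _ => n) (1 * x) (s / T))) := by
    intro s
    simp only [h1, integral_const_mul]
    rw [Measure.integral_comp_div
      (fun x => ψ (gridSum (fun _ : Unit => z) (1 / n) (fun _ => n) (1 * x) (s / T))),
      abs_of_pos hT]
  simp only [h2]
  have h3 := integral_comp_mul_left_Ioi (fun s => a' s • ((q : ℂ) * (T •
    ∫ x, ψ (gridSum (fun _ : Unit => z) (1 / n) (fun _ => n) (1 * x) (s / T))))) 0 hT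
  rw [mul_zero, eq_inv_smul_iff₀ hT.ne', ← integral_smul] at h3
  rw [← h3]
  refine setIntegral_congr_fun measurableSet_Ioi fun σ _ => ?_
  simp only [mul_div_cancel_left₀ σ hT.ne', Complex.real_smul]
  rw [hq]
  push_cast
  have haT' : (a T : ℂ) ≠ 0 := by exact_mod_cast haT.ne'
  have hT' : (T : ℂ) ≠ 0 := by exact_mod_cast hT.ne'
  field_simp

/-- The limit of the exponents in the regime `κ - 1 < β < 2`. -/
lemma tendsto_integral_longScale (ha : IsLongMemoryTrawl a a' κ c) (hβ : κ - 1 < β) (hβ2 : β < 2)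
    (hψ : IsHomogeneousExponent β ψ) (z : ℝ) {Δ : ℕ → ℝ} (hΔ : ∀ n, 0 ≤ Δ n)
    (hΔ0 : Tendsto Δ atTop (𝓝 0))
    (hΔT : Tendsto (fun n : ℕ => (n : ℝ) * Δ n) atTop atTop) :
    Tendsto (fun n : ℕ => ∫ s in Set.Ioi (0 : ℝ), a' s • ∫ r,
        ψ (z * (1 / (n * (a (n * Δ n) * (n * Δ n)) ^ (1 / β))) * gridCount (Δ n) n r s)) atTop
      (𝓝 (longScale κ β * ψ z)) := by
  have hκ := ha.two_lt
  have hβ1 : 1 < β := by linarith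
  obtain ⟨C, hC, hb⟩ := hψ.bound
  obtain ⟨D, hD, hdens⟩ := ha.exists_density_le
  have hdens' := hΔT.eventually hdens
  have hΔ1 : ∀ᶠ n in atTop, Δ n ≤ 1 := (hΔ0.eventually_lt_const one_pos).mono fun _ h => h.le
  have hT0 : ∀ᶠ n : ℕ in atTop, 0 < (n : ℝ) * Δ n := hΔT.eventually_gt_atTop 0
  have hn0 : ∀ᶠ n : ℕ in atTop, (0 : ℝ) < 1 / (n : ℝ) := by
    filter_upwards [eventually_gt_atTop 0] with n hn
    have : (0 : ℝ) < n := by exact_mod_cast hn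
    positivity
  refine Tendsto.congr'
    (hT0.mono fun n hn => (integral_rescale ha (by linarith) hψ z hn).symm) ?_
  have hlim : (longScale κ β * ψ z : ℂ) = ∫ σ in Set.Ioi (0 : ℝ), ((κ - 1) * σ ^ (-κ)) •
      ∫ x, ψ (∑ _j : Unit, z * overlap 1 x σ) := by
    rw [← integral_longScale hκ hβ, ← integral_complex_ofReal, ← integral_mul_const]
    refine setIntegral_congr_fun measurableSet_Ioi fun σ hσ => ?_
    have h1 : ∀ x, ψ (∑ _j : Unit, z * overlap 1 x σ) = ((overlap 1 x σ ^ β : ℝ) : ℂ) * ψ z := by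
      intro x
      rw [← hψ.map_mul _ (overlap_nonneg _ _ _)]
      simp [mul_comm]
    simp only [h1, integral_mul_const, integral_complex_ofReal, Complex.real_smul]
    push_cast
    ring
  rw [hlim]
  set A := C * (∑ _j : Unit, |z|) ^ β with hA
  have hA0 : 0 ≤ A := by positivity
  refine tendsto_integral_filter_of_dominated_convergence
    (fun σ => 3 * D * A * ((Set.Ioc (0 : ℝ) 1).indicator (fun σ => σ ^ (β - κ)) σ +
      (Set.Ioi (1 : ℝ)).indicator (fun σ => σ ^ (1 - κ)) σ)) ?_ ?_ ?_ ?_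
  · filter_upwards [hT0] with n hn
    exact (aestronglyMeasurable_density ha hn).smul
      (stronglyMeasurable_integral_gridSum hψ.continuous _ _ _ _).aestronglyMeasurable
  · filter_upwards [hT0, hdens', hn0, hΔ1] with n hn hd hn1 hd1
    filter_upwards [ae_restrict_mem measurableSet_Ioi] with σ hσ
    have hσ0 : (0 : ℝ) < σ := hσ
    set T := (n : ℝ) * Δ n with hT
    have hnpos : (0 : ℝ) < n := one_div_pos.1 hn1
    have hnn : 1 / (n : ℝ) * n = 1 := one_div_mul_cancel hnpos.ne'
    have hdens0 : 0 ≤ T * a' (T * σ) / a T := by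
      have h1 := ha.pos (T * σ) (by positivity)
      have h2 := ha.pos_apply hn.le
      positivity
    rw [norm_smul, Real.norm_of_nonneg hdens0]
    -- For `σ ≤ 1` the count is controlled by the segment length, for `σ > 1` by the window.
    rcases le_or_gt σ 1 with h1 | h1
    · rw [Set.indicator_of_mem (Set.mem_Ioc.2 ⟨hσ0, h1⟩),
        Set.indicator_of_notMem (by simpa using h1), add_zero]
      have hI := norm_integral_gridSum_le hβ1 hC hb (fun _ : Unit => z) hn1 (m := fun _ => n)
        (M := n) (fun _ => le_rfl) one_pos hσ0.le (fun r => mul_gridCount_le hn1 n r hσ0.le)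
      rw [hnn, div_one, one_mul] at hI
      -- Subadditivity of the power `β - 1 ∈ [0, 1]` isolates the discretisation error `2/n`, which
      -- is not small relative to `σ` near 0.
      have hsub : (σ + 2 * (1 / (n : ℝ))) ^ (β - 1) ≤ σ ^ (β - 1) + (2 * (1 / (n : ℝ))) ^ (β - 1) :=
        Real.rpow_add_le_add_rpow hσ0.le (by positivity) (by linarith) (by linarith)
      have hd2 := hd κ (by linarith) le_rfl σ hσ0
      -- For the error term a weaker power of `σ` is used, at the price of `T^{β-1}`. Since `T / n =
      -- Δ_n ≤ 1`, the factor `(2/n)^{β-1}` absorbs it, and the power of `σ` is again `β - κ`.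
      have hd3 := hd (κ - (β - 1)) (by linarith) (by linarith) σ hσ0
      rw [sub_self, Real.rpow_zero, one_mul] at hd2
      rw [sub_sub_cancel, neg_sub] at hd3
      have hp1 : σ ^ (-κ) * σ ^ (β - 1) * σ = σ ^ (β - κ) := by
        rw [← Real.rpow_add hσ0, ← Real.rpow_add_one hσ0.ne']; ring_nf
      have hp2 : σ ^ (β - 1 - κ) * σ = σ ^ (β - κ) := by
        rw [← Real.rpow_add_one hσ0.ne']; ring_nf
      have hp3 : T ^ (β - 1) * (2 * (1 / (n : ℝ))) ^ (β - 1) ≤ 2 := by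
        rw [← Real.mul_rpow hn.le (by positivity)]
        have h5 : T * (2 * (1 / (n : ℝ))) = 2 * Δ n := by rw [hT]; field_simp
        rw [h5]
        calc (2 * Δ n) ^ (β - 1) ≤ (2 : ℝ) ^ (β - 1) := by
              have := hΔ n
              gcongr
              linarith
          _ ≤ (2 : ℝ) ^ (1 : ℝ) := by
              gcongr
              · norm_num
              · linarith
          _ = 2 := Real.rpow_one 2
      have hσβ : 0 < σ ^ (β - κ) := Real.rpow_pos_of_pos hσ0 _
      have hX : 0 ≤ A * σ := by positivity
      calc T * a' (T * σ) / a T * _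
          ≤ T * a' (T * σ) / a T * (A * (σ + 2 * (1 / (n : ℝ))) ^ (β - 1) * σ) := by gcongr
        _ ≤ T * a' (T * σ) / a T *
            (A * (σ ^ (β - 1) + (2 * (1 / (n : ℝ))) ^ (β - 1)) * σ) := by gcongr
        _ = A * σ * (T * a' (T * σ) / a T * σ ^ (β - 1)) +
            A * σ * (T * a' (T * σ) / a T * (2 * (1 / (n : ℝ))) ^ (β - 1)) := by ring
        _ ≤ A * σ * (D * σ ^ (-κ) * σ ^ (β - 1)) +
            A * σ * (D * (T ^ (β - 1) * σ ^ (β - 1 - κ)) * (2 * (1 / (n : ℝ))) ^ (β - 1)) := by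
            gcongr
        _ = A * D * (σ ^ (-κ) * σ ^ (β - 1) * σ) + A * D * (σ ^ (β - 1 - κ) * σ) *
            (T ^ (β - 1) * (2 * (1 / (n : ℝ))) ^ (β - 1)) := by ring
        _ ≤ A * D * σ ^ (β - κ) + A * D * σ ^ (β - κ) * 2 := by
            rw [hp1, hp2]
            gcongr
        _ = _ := by ring
    · rw [Set.indicator_of_notMem (by simp [h1]), Set.indicator_of_mem (Set.mem_Ioi.2 h1), zero_add]
      have hI := norm_integral_gridSum_le hβ1 hC hb (fun _ : Unit => z) hn1 (m := fun _ => n)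
        (M := n) (fun _ => le_rfl) one_pos hσ0.le (B := 1) (fun r =>
          (mul_le_mul_of_nonneg_left (gridCount_le _ _ _ _) hn1.le).trans_eq hnn)
      rw [hnn, div_one, one_mul, Real.one_rpow, mul_one] at hI
      have hd2 := hd κ (by linarith) le_rfl σ hσ0
      rw [sub_self, Real.rpow_zero, one_mul] at hd2
      have hp1 : σ ^ (-κ) * σ = σ ^ (1 - κ) := by
        rw [← Real.rpow_add_one hσ0.ne']; ring_nf
      have hσβ : 0 < σ ^ (1 - κ) := Real.rpow_pos_of_pos hσ0 _
      calc T * a' (T * σ) / a T * _ ≤ (D * σ ^ (-κ)) * (A * σ) := by gcongr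
        _ = D * A * (σ ^ (-κ) * σ) := by ring
        _ = 1 * (D * A * σ ^ (1 - κ)) := by rw [hp1, one_mul]
        _ ≤ 3 * (D * A * σ ^ (1 - κ)) := by gcongr; norm_num
        _ = _ := by ring
  · refine (Integrable.add ?_ ?_).const_mul _
    · refine Integrable.integrableOn ((integrable_indicator_iff measurableSet_Ioc).2 ?_)
      exact (intervalIntegrable_iff_integrableOn_Ioc_of_le zero_le_one).1
        (intervalIntegral.intervalIntegrable_rpow' (by linarith))
    · exact Integrable.integrableOn ((integrable_indicator_iff measurableSet_Ioi).2
        (integrableOn_Ioi_rpow_of_lt (by linarith) one_pos))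
  · filter_upwards [ae_restrict_mem measurableSet_Ioi] with σ hσ
    have hσ0 : (0 : ℝ) < σ := hσ
    refine ((ha.tendsto_density hσ0).comp hΔT).smul ?_
    -- After rescaling the mesh is `1/n` and the window is `[0, 1]`, so the overlaps are constant in
    -- `n` once `n > 0`.
    refine tendsto_integral_gridSum hβ1 hψ (fun _ : Unit => z) (δ := fun n : ℕ => 1 / (n : ℝ))
      (T := fun _ => 1) (m := fun _ n => n) (M := fun n => n) (τ := 1) hn0
      tendsto_one_div_atTop_nhds_zero_nat (Eventually.of_forall fun _ => le_rfl)
      (fun _ _ => le_rfl) ?_ hσ0.le ?_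
    · filter_upwards [hn0] with n hn
      rw [one_div_mul_cancel (one_div_pos.1 hn).ne', one_mul]
    · refine ae_of_all _ fun x _ => tendsto_const_nhds.congr' ?_
      filter_upwards [hn0] with n hn
      rw [one_div_mul_cancel (one_div_pos.1 hn).ne', one_mul]

end LongScale

end TrawlLimit

namespace TrawlLimit

/-! ### Finite-dimensional distributions of Lévy processes -/

section LevyProcess

variable {Ω : Type*} [MeasurableSpace Ω] {P : Measure Ω} {Y : ℝ≥0 → Ω → ℝ} {ψ : ℝ → ℂ}

lemma IsLevyProcess.charFun_add [IsProbabilityMeasure P] (hY : IsLevyProcess Y P) (s t : ℝ≥0)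
    (z : ℝ) :
    charFun (P.map (Y (s + t))) z = charFun (P.map (Y s)) z * charFun (P.map (Y t)) z := by
  have h := hY.indep_increments.indepFun_eval_sub zero_le (le_self_add : s ≤ s + t)
    hY.start_zero
  have h2 := h.charFun_map_add_eq_mul (hY.measurable s).aemeasurable
    ((hY.measurable (s + t)).sub (hY.measurable s)).aemeasurable
  have h3 : P.map (Y (s + t) - Y s) = P.map (Y t) := (hY.stationary_increments s t).map_eq
  rw [add_sub_cancel, h3] at h2
  rw [h2, Pi.mul_apply]

lemma IsLevyProcess.charFun_zero [IsProbabilityMeasure P] (hY : IsLevyProcess Y P) (z : ℝ) :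
    charFun (P.map (Y 0)) z = 1 := by
  rw [Measure.map_congr (show Y 0 =ᵐ[P] fun _ => (0 : ℝ) from hY.start_zero), Measure.map_const]
  simp

lemma IsLevyProcess.charFun_nsmul [IsProbabilityMeasure P] (hY : IsLevyProcess Y P) (n : ℕ)
    (t : ℝ≥0) (z : ℝ) :
    charFun (P.map (Y (n * t))) z = charFun (P.map (Y t)) z ^ n := by
  induction n with
  | zero => simpa using hY.charFun_zero z
  | succ n ih => rw [Nat.cast_succ, add_mul, one_mul, hY.charFun_add, ih, pow_succ]

lemma IsLevyProcess.tendsto_charFun [IsProbabilityMeasure P] (hY : IsLevyProcess Y P) {t : ℝ≥0}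
    {u : ℕ → ℝ≥0} (hu : Tendsto u atTop (𝓝 t)) (z : ℝ) :
    Tendsto (fun n => charFun (P.map (Y (u n))) z) atTop (𝓝 (charFun (P.map (Y t)) z)) := by
  have h1 : TendstoInMeasure P (fun n => Y (u n)) atTop (Y t) :=
    fun ε hε => (hY.stochastically_continuous t ε hε).comp hu
  have h2 := (h1.tendstoInDistribution fun n => (hY.measurable (u n)).aemeasurable).tendsto
  exact ProbabilityMeasure.tendsto_iff_tendsto_charFun.1 h2 z

/-- A continuous function on `ℝ` whose `q`-th power is `1` is constant. -/
lemma eq_one_of_pow_eq_one {h : ℝ → ℂ} (hc : Continuous h) {q : ℕ} (hq : 0 < q)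
    (hp : ∀ z, h z ^ q = 1) (h0 : h 0 = 1) (z : ℝ) : h z = 1 := by
  have hfin : ((Polynomial.nthRootsFinset q (1 : ℂ) : Finset ℂ) : Set ℂ).Finite :=
    Finset.finite_toSet _
  have := isPreconnected_univ.constant_of_mapsTo hfin.isDiscrete hc.continuousOn
    (fun x _ => by simpa [Polynomial.mem_nthRootsFinset hq] using hp x)
    (Set.mem_univ z) (Set.mem_univ 0)
  rw [this, h0]

/-- The marginals of a Lévy process are determined by its value at time `1`. -/
lemma IsLevyProcess.charFun_eq [IsProbabilityMeasure P] (hY : IsLevyProcess Y P)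
    (hψ : Continuous ψ) (hψ0 : ψ 0 = 0)
    (h1 : ∀ z, charFun (P.map (Y 1)) z = Complex.exp (ψ z)) (t : ℝ≥0) (z : ℝ) :
    charFun (P.map (Y t)) z = Complex.exp (t * ψ z) := by
  -- The `q`-th power identity fixes the characteristic function at time `1/q` only up to a root of
  -- unity. Continuity in `z` and the value 1 at `z = 0` remove the ambiguity.
  have hroot : ∀ q : ℕ, 0 < q → ∀ z : ℝ,
      charFun (P.map (Y (1 / q))) z = Complex.exp (((1 / q : ℝ) : ℂ) * ψ z) := by
    intro q hq z
    have hq' : (q : ℂ) ≠ 0 := by exact_mod_cast hq.ne'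
    have hq'' : (q : ℝ≥0) ≠ 0 := by exact_mod_cast hq.ne'
    have := Measure.isProbabilityMeasure_map (μ := P) (hY.measurable (1 / q)).aemeasurable
    have key := eq_one_of_pow_eq_one
      (h := fun z => charFun (P.map (Y (1 / q))) z * Complex.exp (-(((1 / q : ℝ) : ℂ) * ψ z)))
      (by
        refine continuous_charFun.mul (Complex.continuous_exp.comp ?_)
        fun_prop) hq
      (fun z => by
        rw [mul_pow, ← hY.charFun_nsmul, mul_one_div_cancel hq'', h1, ← Complex.exp_nat_mul,
          ← Complex.exp_add]
        push_cast
        rw [mul_neg, ← mul_assoc, mul_one_div_cancel hq', one_mul, add_neg_cancel, Complex.exp_zero])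
      (by simp only [hψ0, mul_zero, neg_zero, Complex.exp_zero, mul_one, MeasureTheory.charFun_zero,
        probReal_univ, Complex.ofReal_one]) z
    rw [Complex.exp_neg, mul_inv_eq_one₀ (Complex.exp_ne_zero _)] at key
    exact key
  have hrat : ∀ p q : ℕ, 0 < q → charFun (P.map (Y (p / q))) z =
      Complex.exp ((((p / q : ℝ≥0) : ℝ) : ℂ) * ψ z) := by
    intro p q hq
    rw [show (p / q : ℝ≥0) = p * (1 / q) by rw [mul_one_div], hY.charFun_nsmul, hroot q hq,
      ← Complex.exp_nat_mul]
    push_cast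
    rw [mul_assoc]
  -- Rational times `⌊tn⌋ / n` approximate `t`, and stochastic continuity carries the formula to the
  -- limit.
  set u : ℕ → ℝ≥0 := fun n => (⌊(t : ℝ) * n⌋₊ : ℝ≥0) / n with hu
  have hut : Tendsto u atTop (𝓝 t) := by
    rw [← NNReal.tendsto_coe]
    have := (tendsto_nat_floor_mul_div_atTop (R := ℝ) t.2).comp tendsto_natCast_atTop_atTop
    refine this.congr fun n => ?_
    simp [hu]
  have hl := hY.tendsto_charFun hut z
  have hr : Tendsto (fun n => Complex.exp (((u n : ℝ) : ℂ) * ψ z)) atTop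
      (𝓝 (Complex.exp (((t : ℝ) : ℂ) * ψ z))) := by
    have hc : Continuous fun v : ℝ≥0 => Complex.exp (((v : ℝ) : ℂ) * ψ z) := by fun_prop
    exact (hc.tendsto t).comp hut
  refine tendsto_nhds_unique (hl.congr' ?_) hr
  filter_upwards [eventually_gt_atTop 0] with n hn
  exact hrat _ n hn

lemma IsLevyProcess.integral_exp_increments [IsProbabilityMeasure P] (hY : IsLevyProcess Y P)
    (hφ : ∀ (t : ℝ≥0) (z : ℝ), charFun (P.map (Y t)) z = Complex.exp (t * ψ z))
    {τ : ℕ → ℝ≥0} (hτ : Monotone τ) (θ : ℕ → ℝ) (k : ℕ) :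
    ∫ ω, Complex.exp (Complex.I *
        ((∑ i ∈ Finset.range k, θ i * (Y (τ (i + 1)) ω - Y (τ i) ω) : ℝ) : ℂ)) ∂P =
      Complex.exp (∑ i ∈ Finset.range k, (((τ (i + 1) : ℝ) - τ i : ℝ) : ℂ) * ψ (θ i)) := by
  have hind := (hY.indep_increments.nat hτ).precomp (g := fun i : Fin k => (i : ℕ)) Fin.val_injective
  have hmeas : ∀ i : ℕ, Measurable fun ω => Y (τ (i + 1)) ω - Y (τ i) ω :=
    fun i => (hY.measurable _).sub (hY.measurable _)
  have hprod := hind.integral_fun_prod_comp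
    (f := fun (i : Fin k) x => Complex.exp (Complex.I * ((θ i * x : ℝ) : ℂ)))
    (fun i => (hmeas i).aemeasurable)
    (fun i => (by fun_prop : Continuous _).aestronglyMeasurable)
  have hone : ∀ i : ℕ, ∫ ω, Complex.exp (Complex.I *
      ((θ i * (Y (τ (i + 1)) ω - Y (τ i) ω) : ℝ) : ℂ)) ∂P =
      Complex.exp ((((τ (i + 1) : ℝ) - τ i : ℝ) : ℂ) * ψ (θ i)) := by
    intro i
    have hle := hτ (Nat.le_succ i)
    have h1 := (hY.stationary_increments (τ i) (τ (i + 1) - τ i)).map_eq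
    rw [add_tsub_cancel_of_le hle] at h1
    have h2 := hφ (τ (i + 1) - τ i) (θ i)
    rw [← h1, charFun_apply_real, integral_map (hmeas i).aemeasurable (by fun_prop),
      NNReal.coe_sub hle] at h2
    rw [← h2]
    congr 1; ext ω
    push_cast
    ring_nf
  calc _ = ∫ ω, ∏ i : Fin k, Complex.exp (Complex.I *
        ((θ i * (Y (τ (i + 1)) ω - Y (τ i) ω) : ℝ) : ℂ)) ∂P := by
        congr 1; ext ω
        rw [← Complex.exp_sum, Finset.sum_range, Complex.ofReal_sum, Finset.mul_sum]
    _ = _ := by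
        rw [hprod, Complex.exp_sum, Finset.prod_range]
        exact Finset.prod_congr rfl fun i _ => hone i

/-- Summation by parts. -/
lemma sum_range_mul_sub_zero (θ f : ℕ → ℝ) (k : ℕ) :
    ∑ j ∈ Finset.range k, θ j * (f (j + 1) - f 0) =
      ∑ i ∈ Finset.range k, (∑ j ∈ Finset.Ico i k, θ j) * (f (i + 1) - f i) := by
  simp only [← Finset.sum_range_sub f, Finset.mul_sum, Finset.sum_mul, Finset.range_eq_Ico]
  exact (Finset.sum_Ico_Ico_comm 0 k fun i j => θ j * (f (i + 1) - f i)).symm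

lemma indicator_Ioc_sub (x : ℝ) {s t : ℝ} (hs : 0 ≤ s) (hst : s ≤ t) :
    (Set.Ioc 0 t).indicator (fun _ => (1 : ℝ)) x - (Set.Ioc 0 s).indicator (fun _ => (1 : ℝ)) x =
      (Set.Ioc s t).indicator (fun _ => (1 : ℝ)) x := by
  simp only [Set.indicator_apply, Set.mem_Ioc]
  split_ifs <;> grind

/-- The intervals are disjoint, so at each point at most one term of the sum is nonzero and `ψ` acts
on the step function piece by piece. -/
lemma integral_step (hψ0 : ψ 0 = 0) {τ : ℕ → ℝ≥0} (hτ : Monotone τ) (θ : ℕ → ℝ) (k : ℕ) :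
    ∫ x, ψ (∑ i ∈ Finset.range k,
        θ i * (Set.Ioc (τ i : ℝ) (τ (i + 1))).indicator (fun _ => (1 : ℝ)) x) =
      ∑ i ∈ Finset.range k, (((τ (i + 1) : ℝ) - τ i : ℝ) : ℂ) * ψ (θ i) := by
  have hτ' : Monotone fun i => (τ i : ℝ) := fun i j h => NNReal.coe_le_coe.2 (hτ h)
  have hd := hτ'.pairwise_disjoint_on_Ioc_succ
  have hfun : ∀ x, ψ (∑ i ∈ Finset.range k,
        θ i * (Set.Ioc (τ i : ℝ) (τ (i + 1))).indicator (fun _ => (1 : ℝ)) x) =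
      ∑ i ∈ Finset.range k, (Set.Ioc (τ i : ℝ) (τ (i + 1))).indicator (fun _ => ψ (θ i)) x := by
    intro x
    by_cases h : ∃ i ∈ Finset.range k, x ∈ Set.Ioc (τ i : ℝ) (τ (i + 1))
    · obtain ⟨i, hi, hx⟩ := h
      have hne : ∀ j, j ≠ i → x ∉ Set.Ioc (τ j : ℝ) (τ (j + 1)) :=
        fun j hj hx' => (hd hj).le_bot ⟨hx', hx⟩
      rw [Finset.sum_eq_single_of_mem i hi fun j _ hj => by
          rw [Set.indicator_of_notMem (hne j hj), mul_zero],
        Finset.sum_eq_single_of_mem i hi fun j _ hj => Set.indicator_of_notMem (hne j hj) _,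
        Set.indicator_of_mem hx, Set.indicator_of_mem hx, mul_one]
    · push Not at h
      rw [Finset.sum_eq_zero fun i hi => by rw [Set.indicator_of_notMem (h i hi), mul_zero],
        Finset.sum_eq_zero fun i hi => Set.indicator_of_notMem (h i hi) _, hψ0]
  simp only [hfun]
  rw [integral_finsetSum _ fun i _ =>
    (integrable_indicator_iff measurableSet_Ioc).2 (integrableOn_const (by simp))]
  refine Finset.sum_congr rfl fun i _ => ?_
  rw [integral_indicator measurableSet_Ioc, setIntegral_const, Complex.real_smul, measureReal_def,
    Real.volume_Ioc, ENNReal.toReal_ofReal (sub_nonneg.2 (hτ' (Nat.le_succ i)))]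

/-- The finite-dimensional characteristic functions of a Lévy process. -/
theorem IsLevyProcess.integral_exp_sum [IsProbabilityMeasure P] (hY : IsLevyProcess Y P)
    (hψ0 : ψ 0 = 0) (hφ : ∀ (t : ℝ≥0) (z : ℝ), charFun (P.map (Y t)) z = Complex.exp (t * ψ z))
    {k : ℕ} (t : Fin k → ℝ≥0) (θ : Fin k → ℝ) :
    ∫ ω, Complex.exp (Complex.I * ((∑ j, θ j * Y (t j) ω : ℝ) : ℂ)) ∂P =
      Complex.exp (∫ x, ψ (∑ j, θ j * (Set.Ioo 0 (t j : ℝ)).indicator (fun _ => (1 : ℝ)) x)) := by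
  set σ := Tuple.sort t with hσ
  have hmono := Tuple.monotone_sort t
  -- The sorted times preceded by 0. Beyond the last one the sequence is constant at `∑ t i`, an
  -- upper bound that keeps it monotone.
  set τ : ℕ → ℝ≥0 := fun
    | 0 => 0
    | j + 1 => if h : j < k then t (σ ⟨j, h⟩) else ∑ i, t i with hτdef
  have hτ0 : τ 0 = 0 := rfl
  have hτs : ∀ j : Fin k, τ (j + 1) = t (σ j) := fun j => by simp [hτdef]
  have hτ : Monotone τ := by
    refine monotone_nat_of_le_succ fun n => ?_
    cases n with
    | zero => exact zero_le
    | succ j =>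
      simp only [hτdef]
      split_ifs with h1 h2 h2
      · exact hmono (Fin.mk_le_mk.2 (Nat.le_succ j))
      · exact Finset.single_le_sum (fun i _ => zero_le) (Finset.mem_univ _)
      · omega
      · exact le_rfl
  set θ' : ℕ → ℝ := fun j => if h : j < k then θ (σ ⟨j, h⟩) else 0 with hθ'
  have hθs : ∀ j : Fin k, θ' j = θ (σ j) := fun j => by simp [hθ']
  have hreindex : ∀ g : ℝ≥0 → ℝ,
      ∑ j, θ j * g (t j) = ∑ j ∈ Finset.range k, θ' j * g (τ (j + 1)) := by
    intro g
    rw [← Equiv.sum_comp σ, Finset.sum_range]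
    simp only [hτs, hθs]
  have hleft : ∀ᵐ ω ∂P, ∑ j, θ j * Y (t j) ω =
      ∑ i ∈ Finset.range k, (∑ j ∈ Finset.Ico i k, θ' j) * (Y (τ (i + 1)) ω - Y (τ i) ω) := by
    filter_upwards [hY.start_zero] with ω hω
    rw [hreindex fun s => Y s ω, ← sum_range_mul_sub_zero θ' fun i => Y (τ i) ω]
    simp only [hτ0, hω, sub_zero]
  have hright : ∀ᵐ x : ℝ, ψ (∑ j, θ j * (Set.Ioo 0 (t j : ℝ)).indicator (fun _ => (1 : ℝ)) x) =
      ψ (∑ i ∈ Finset.range k, (∑ j ∈ Finset.Ico i k, θ' j) *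
        (Set.Ioc (τ i : ℝ) (τ (i + 1))).indicator (fun _ => (1 : ℝ)) x) := by
    -- Open intervals come from the overlap limit, half-open ones telescope; they differ on a null
    -- set.
    filter_upwards [ae_ne_and_ne fun j => (t j : ℝ)] with x hx
    congr 1
    have h1 : ∀ j, (Set.Ioo 0 (t j : ℝ)).indicator (fun _ => (1 : ℝ)) x =
        (Set.Ioc 0 (t j : ℝ)).indicator (fun _ => (1 : ℝ)) x := by
      intro j
      have : x ∈ Set.Ioo 0 (t j : ℝ) ↔ x ∈ Set.Ioc 0 (t j : ℝ) :=
        ⟨fun h => ⟨h.1, h.2.le⟩, fun h => ⟨h.1, h.2.lt_of_ne (hx.2 j)⟩⟩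
      simp only [Set.indicator_apply, this]
    simp only [h1]
    rw [hreindex fun s => (Set.Ioc 0 (s : ℝ)).indicator (fun _ => (1 : ℝ)) x]
    have h2 := sum_range_mul_sub_zero θ'
      (fun i => (Set.Ioc 0 (τ i : ℝ)).indicator (fun _ => (1 : ℝ)) x) k
    simp only [hτ0, NNReal.coe_zero, Set.Ioc_self, Set.indicator_empty, sub_zero] at h2
    rw [h2]
    refine Finset.sum_congr rfl fun i _ => ?_
    congr 1
    exact indicator_Ioc_sub x (τ i).2 (NNReal.coe_le_coe.2 (hτ (Nat.le_add_right i 1)))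
  rw [integral_congr_ae hright, integral_step hψ0 hτ, ← hY.integral_exp_increments hφ hτ]
  refine integral_congr_ae ?_
  filter_upwards [hleft] with ω hω
  rw [hω]

end LevyProcess

end TrawlLimit

namespace TrawlLimit

/-! ### A Lévy process built from a Lévy basis -/

section Existence

/-- The rectangle `(p, q] × [0, 1]`. -/
def strip (p q : ℝ) : Set (ℝ × ℝ) := Set.Ioc p q ×ˢ Set.Icc 0 1

lemma measurableSet_strip (p q : ℝ) : MeasurableSet (strip p q) :=
  measurableSet_Ioc.prod measurableSet_Icc

lemma volume_strip (p q : ℝ) : volume (strip p q) = ENNReal.ofReal (q - p) := by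
  rw [strip, Measure.volume_eq_prod, Measure.prod_prod]
  simp

lemma volume_strip_lt_top (p q : ℝ) : volume (strip p q) < ∞ := by
  rw [volume_strip]; exact ENNReal.ofReal_lt_top

lemma strip_union {p q r : ℝ} (hpq : p ≤ q) (hqr : q ≤ r) :
    strip p q ∪ strip q r = strip p r := by
  rw [strip, strip, ← Set.union_prod, Set.Ioc_union_Ioc_eq_Ioc hpq hqr, strip]

lemma disjoint_strip {p q p' q' : ℝ} (h : Disjoint (Set.Ioc p q) (Set.Ioc p' q')) :
    Disjoint (strip p q) (strip p' q') :=
  Set.disjoint_prod.2 (Or.inl h)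

variable {Ω : Type*} [MeasurableSpace Ω] {P : Measure Ω}
  {L : Set (ℝ × ℝ) → Ω → ℝ} {γ b : ℝ} {ν : Measure ℝ}

namespace IsHomogeneousLevyBasis

lemma charFun_strip (hL : IsHomogeneousLevyBasis P L γ b ν) {p q : ℝ} (h : p ≤ q) (z : ℝ) :
    charFun (P.map (L (strip p q))) z =
      Complex.exp (((q - p : ℝ) : ℂ) * levyExponent γ b ν z) := by
  rw [hL.charFun_eq _ (measurableSet_strip p q) (volume_strip_lt_top p q), volume_strip,
    ENNReal.toReal_ofReal (sub_nonneg.2 h)]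

lemma measurable_strip (hL : IsHomogeneousLevyBasis P L γ b ν) (p q : ℝ) :
    Measurable (L (strip p q)) :=
  hL.measurable _ (measurableSet_strip p q) (volume_strip_lt_top p q)

lemma strip_sub [IsProbabilityMeasure P] (hL : IsHomogeneousLevyBasis P L γ b ν)
    {p q r : ℝ} (hpq : p ≤ q) (hqr : q ≤ r) :
    ∀ᵐ ω ∂P, L (strip p r) ω - L (strip p q) ω = L (strip q r) ω := by
  have h := hL.union (measurableSet_strip p q) (measurableSet_strip q r)
    (volume_strip_lt_top p q) (volume_strip_lt_top q r)
    (disjoint_strip (Set.Ioc_disjoint_Ioc_of_le le_rfl))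
  rw [strip_union hpq hqr] at h
  filter_upwards [h] with ω hω
  rw [hω]; ring

/-- The truncation inequality bounds tails by the characteristic function near 0. The level `ε / 2`
turns the strict inequality there into the non-strict one here. -/
lemma measureReal_strip_le [IsProbabilityMeasure P] (hL : IsHomogeneousLevyBasis P L γ b ν)
    {ε : ℝ} (hε : 0 < ε) {p q : ℝ}
    (h : p ≤ q) :
    P.real {ω | ε ≤ ‖L (strip p q) ω‖} ≤ 2⁻¹ * (ε / 2) *
      ‖∫ t in -2 * (ε / 2)⁻¹..2 * (ε / 2)⁻¹,
        1 - Complex.exp (((q - p : ℝ) : ℂ) * levyExponent γ b ν t)‖ := by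
  have hm := hL.measurable_strip p q
  have := Measure.isProbabilityMeasure_map (μ := P) hm.aemeasurable
  have h1 := measureReal_abs_gt_le_integral_charFun (μ := P.map (L (strip p q))) (half_pos hε)
  simp only [hL.charFun_strip h] at h1
  refine le_trans ?_ h1
  have hms : MeasurableSet {x : ℝ | ε / 2 < |x|} :=
    measurableSet_lt measurable_const continuous_abs.measurable
  rw [map_measureReal_apply hm hms]
  refine measureReal_mono fun ω hω => ?_
  have h2 : ε ≤ ‖L (strip p q) ω‖ := hω
  have : ε / 2 < |L (strip p q) ω| := by
    rw [← Real.norm_eq_abs]; linarith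
  exact this

/-- The process `t ↦ L((0, ρt] × [0, 1])` is a Lévy process. -/
theorem isLevyProcess_strip [IsProbabilityMeasure P]
    (hL : IsHomogeneousLevyBasis P L γ b ν)
    (hψ : Continuous (levyExponent γ b ν)) {ρ : ℝ} (hρ : 0 ≤ ρ) :
    IsLevyProcess (fun t : ℝ≥0 => L (strip 0 (ρ * t))) P where
  measurable t := hL.measurable_strip _ _
  start_zero := hL.ae_eq_zero_of_volume_eq_zero (measurableSet_strip _ _) (by simp [volume_strip])
  indep_increments := by
    intro n t ht
    have hmono : Monotone fun i => ρ * (t i : ℝ) := fun i j hij =>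
      mul_le_mul_of_nonneg_left (NNReal.coe_le_coe.2 (ht hij)) hρ
    refine iIndepFun.congr (f := fun i : Fin n => L (strip (ρ * t i.castSucc) (ρ * t i.succ)))
      (fun i => ?_) ?_
    · have := hL.strip_sub (p := 0) (q := ρ * t i.castSucc) (r := ρ * t i.succ)
        (by positivity) (hmono i.castSucc_le_succ)
      filter_upwards [this] with ω hω
      exact hω.symm
    · refine hL.iIndepFun_of_pairwise_disjoint _ (fun i => measurableSet_strip _ _)
        (fun i => volume_strip_lt_top _ _) ?_
      have key : ∀ i j : Fin n, i < j → Disjoint (strip (ρ * t i.castSucc) (ρ * t i.succ))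
          (strip (ρ * t j.castSucc) (ρ * t j.succ)) := fun i j hij =>
        disjoint_strip (Set.Ioc_disjoint_Ioc_of_le (hmono (Fin.succ_le_castSucc_iff.2 hij)))
      intro i j hij
      rcases hij.lt_or_gt with h | h
      · exact key i j h
      · exact (key j i h).symm
  stationary_increments s t := by
    have hm := hL.measurable_strip
    refine ⟨((hm _ _).sub (hm _ _)).aemeasurable, (hm _ _).aemeasurable, ?_⟩
    have hle : ρ * s ≤ ρ * ((s + t : ℝ≥0) : ℝ) := by
      push_cast
      nlinarith [mul_nonneg hρ t.2, t.2]
    have h1 := hL.strip_sub (p := 0) (q := ρ * s) (r := ρ * ((s + t : ℝ≥0) : ℝ))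
      (by positivity) hle
    rw [Measure.map_congr h1]
    have := Measure.isProbabilityMeasure_map (μ := P)
      (hm (ρ * s) (ρ * ((s + t : ℝ≥0) : ℝ))).aemeasurable
    have := Measure.isProbabilityMeasure_map (μ := P) (hm 0 (ρ * t)).aemeasurable
    refine Measure.ext_of_charFun ?_
    ext z
    rw [hL.charFun_strip hle, hL.charFun_strip (by positivity)]
    push_cast
    ring_nf
  stochastically_continuous t := by
    rw [tendstoInMeasure_iff_measureReal_norm]
    intro ε hε
    -- Tail bound as a function of the width `v` of the strip. It is continuous and vanishes at `v =
    -- 0`, which gives stochastic continuity.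
    set F : ℝ → ℝ := fun v => 2⁻¹ * (ε / 2) * ‖∫ t in -2 * (ε / 2)⁻¹..2 * (ε / 2)⁻¹,
        1 - Complex.exp ((v : ℂ) * levyExponent γ b ν t)‖ with hF
    have hFc : Continuous F := by
      have hc : Continuous (Function.uncurry fun (v t : ℝ) =>
          1 - Complex.exp ((v : ℂ) * levyExponent γ b ν t)) := by
        refine continuous_const.sub (Complex.continuous_exp.comp ?_)
        exact (Complex.continuous_ofReal.comp continuous_fst).mul (hψ.comp continuous_snd)
      exact continuous_const.mul
        (intervalIntegral.continuous_parametric_intervalIntegral_of_continuous' hc _ _).norm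
    have hF0 : F 0 = 0 := by simp [hF]
    have hlim : Tendsto (fun s : ℝ≥0 => F |ρ * s - ρ * t|) (𝓝 t) (𝓝 0) := by
      have hc : Continuous fun s : ℝ≥0 => F |ρ * s - ρ * t| := hFc.comp (by fun_prop)
      have := hc.tendsto t
      simpa [hF0] using this
    refine squeeze_zero (fun _ => measureReal_nonneg) (fun s => ?_) hlim
    rcases le_total s t with h | h
    · have hle : ρ * s ≤ ρ * t := mul_le_mul_of_nonneg_left (NNReal.coe_le_coe.2 h) hρ
      have h1 := hL.strip_sub (p := 0) (q := ρ * s) (r := ρ * t) (by positivity) hle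
      rw [abs_of_nonpos (by linarith), neg_sub]
      refine le_trans (le_of_eq ?_) (hL.measureReal_strip_le hε hle)
      refine measureReal_congr ?_
      filter_upwards [h1] with ω hω
      refine propext ?_
      change ε ≤ ‖_‖ ↔ ε ≤ ‖_‖
      rw [← hω, norm_sub_rev]
    · have hle : ρ * t ≤ ρ * s := mul_le_mul_of_nonneg_left (NNReal.coe_le_coe.2 h) hρ
      have h1 := hL.strip_sub (p := 0) (q := ρ * t) (r := ρ * s) (by positivity) hle
      rw [abs_of_nonneg (by linarith)]
      refine le_trans (le_of_eq ?_) (hL.measureReal_strip_le hε hle)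
      refine measureReal_congr ?_
      filter_upwards [h1] with ω hω
      refine propext ?_
      change ε ≤ ‖_‖ ↔ ε ≤ ‖_‖
      rw [← hω]

end IsHomogeneousLevyBasis

end Existence

/-! ### Partial sums of the trawl process -/

section PartialSums

variable {Ω : Type*} [MeasurableSpace Ω] {P : Measure Ω}
  {L : Set (ℝ × ℝ) → Ω → ℝ} {γ b : ℝ} {ν : Measure ℝ} {a a' : ℝ → ℝ} {κ c : ℝ}

lemma measurable_trawlProcess (hL : IsHomogeneousLevyBasis P L γ b ν)
    (ha : IsLongMemoryTrawl a a' κ c) (t : ℝ) : Measurable (trawlProcess L a t) :=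
  hL.measurable _ (ha.measurableSet_trawlSetAt t) (ha.volume_trawlSetAt_lt_top t)

lemma measurable_partialSum [IsProbabilityMeasure P]
    (hL : IsHomogeneousLevyBasis P L γ b ν)
    (ha : IsLongMemoryTrawl a a' κ c) (δ : ℝ) (m : ℕ) : Measurable (partialSum P L a δ m) :=
  Finset.measurable_fun_sum _ fun _ _ => (measurable_trawlProcess hL ha _).sub_const _

lemma partialSum_eq [IsProbabilityMeasure P]
    (hL : IsHomogeneousLevyBasis P L γ b ν) (ha : IsLongMemoryTrawl a a' κ c)
    {β : ℝ} (hβ : 1 < β) (hψ : IsHomogeneousExponent β (levyExponent γ b ν)) (δ : ℝ) (m : ℕ)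
    (ω : Ω) : partialSum P L a δ m ω = ∑ k ∈ Finset.range m, L (trawlSetAt a (δ * k)) ω := by
  refine Finset.sum_congr rfl fun k _ => ?_
  rw [integral_eq_zero_of_charFun (measurable_trawlProcess hL ha _) hψ hβ _
    (hL.charFun_eq _ (ha.measurableSet_trawlSetAt _) (ha.volume_trawlSetAt_lt_top _)), sub_zero]
  rfl

/-- The joint characteristic function of partial sums of the trawl process. -/
lemma integral_exp_sum_partialSum [IsProbabilityMeasure P]
    (hL : IsHomogeneousLevyBasis P L γ b ν)
    (ha : IsLongMemoryTrawl a a' κ c) {β : ℝ} (hβ : 1 < β)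
    (hψ : IsHomogeneousExponent β (levyExponent γ b ν)) {ι : Type*} [Fintype ι] (θ : ι → ℝ)
    (δ : ℝ) (m : ι → ℕ) :
    ∫ ω, Complex.exp (Complex.I * ((∑ j, θ j * partialSum P L a δ (m j) ω : ℝ) : ℂ)) ∂P =
      Complex.exp (∫ s in Set.Ioi (0 : ℝ), a' s •
        ∫ r, levyExponent γ b ν (∑ j, θ j * gridCount δ (m j) r s)) := by
  -- The index type lists the trawl sets separately for each `j`. The same set may occur several
  -- times, since the joint formula requires no disjointness.
  obtain ⟨hint, h⟩ := hL.integral_exp_sum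
    (fun p : Σ j, Fin (m j) => trawlSetAt a (δ * (p.2 : ℕ)))
    (fun p => ha.measurableSet_trawlSetAt _) (fun p => ha.volume_trawlSetAt_lt_top _)
    (fun p => θ p.1)
  have h1 : ∀ ω, ∑ j, θ j * partialSum P L a δ (m j) ω =
      ∑ p : Σ j, Fin (m j), θ p.1 * L (trawlSetAt a (δ * (p.2 : ℕ))) ω := by
    intro ω
    rw [Fintype.sum_sigma]
    refine Finset.sum_congr rfl fun j _ => ?_
    rw [partialSum_eq hL ha hβ hψ, Finset.sum_range, Finset.mul_sum]
  simp only [h1]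
  rw [h, ha.integral_eq hint]
  · congr 1
    refine setIntegral_congr_fun measurableSet_Ioi fun s hs => ?_
    have hs0 : (0 : ℝ) < s := hs
    congr 1
    refine integral_congr_ae (ae_of_all _ fun r => ?_)
    simp only
    congr 1
    rw [Fintype.sum_sigma]
    refine Finset.sum_congr rfl fun j _ => ?_
    rw [gridCount, Finset.sum_range, Finset.mul_sum]
    refine Finset.sum_congr rfl fun k _ => ?_
    have hiff := ha.mem_trawlSetAt_apply hs0.le (δ * (k : ℕ)) r
    by_cases hmem : (r, a s) ∈ trawlSetAt a (δ * (k : ℕ))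
    · rw [Set.indicator_of_mem hmem, if_pos (hiff.1 hmem)]
    · rw [Set.indicator_of_notMem hmem, if_neg fun h => hmem (hiff.2 h)]
  · intro p hp
    rw [Finset.sum_eq_zero, levyExponent_zero]
    intro i _
    rw [Set.indicator_of_notMem fun h => hp (ha.snd_le_of_mem_trawlSetAt h), mul_zero]

end PartialSums

/-! ### Convergence in distribution from characteristic functions -/

section Convergence

variable {Ω Ω' : Type*} [MeasurableSpace Ω] [MeasurableSpace Ω'] {P : Measure Ω}
  {P' : Measure Ω'}

lemma charFun_map_toLp {k : ℕ} {X : Ω → Fin k → ℝ} (hX : Measurable X)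
    (t : EuclideanSpace ℝ (Fin k)) :
    charFun (P.map fun ω => (WithLp.toLp 2 (X ω) : EuclideanSpace ℝ (Fin k))) t =
      ∫ ω, Complex.exp (Complex.I * ((∑ j, t j * X ω j : ℝ) : ℂ)) ∂P := by
  have hm : Measurable fun ω => (WithLp.toLp 2 (X ω) : EuclideanSpace ℝ (Fin k)) :=
    (WithLp.measurable_toLp 2 _).comp hX
  rw [charFun_apply, integral_map hm.aemeasurable (by fun_prop)]
  refine integral_congr_ae (ae_of_all _ fun ω => ?_)
  simp only [PiLp.inner_apply, RCLike.inner_apply, conj_trivial]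
  rw [mul_comm]

/-- Lévy's continuity theorem is applied in `EuclideanSpace`, and the conclusion is carried back by
the continuous map `WithLp.ofLp`. -/
lemma tendstoInDistribution_of_tendsto_charFun [IsProbabilityMeasure P] [IsProbabilityMeasure P']
    {k : ℕ} {X : ℕ → Ω → Fin k → ℝ}
    {Z : Ω' → Fin k → ℝ} (hX : ∀ n, Measurable (X n)) (hZ : Measurable Z)
    (h : ∀ θ : Fin k → ℝ, Tendsto
      (fun n => ∫ ω, Complex.exp (Complex.I * ((∑ j, θ j * X n ω j : ℝ) : ℂ)) ∂P) atTop
      (𝓝 (∫ ω, Complex.exp (Complex.I * ((∑ j, θ j * Z ω j : ℝ) : ℂ)) ∂P'))) :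
    TendstoInDistribution X atTop Z (fun _ => P) P' := by
  have hto : Measurable (WithLp.toLp 2 : (Fin k → ℝ) → EuclideanSpace ℝ (Fin k)) :=
    WithLp.measurable_toLp 2 _
  have key : TendstoInDistribution (fun n ω => WithLp.toLp 2 (X n ω)) atTop
      (fun ω => WithLp.toLp 2 (Z ω)) (fun _ => P) P' := by
    refine ⟨fun n => (hto.comp (hX n)).aemeasurable, (hto.comp hZ).aemeasurable, ?_⟩
    refine ProbabilityMeasure.tendsto_of_tendsto_charFun fun t => ?_
    have h2 := h t
    simp only [ProbabilityMeasure.coe_mk]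
    rw [charFun_map_toLp hZ]
    refine h2.congr fun n => ?_
    rw [charFun_map_toLp (hX n)]
  have hof : Continuous (WithLp.ofLp : EuclideanSpace ℝ (Fin k) → Fin k → ℝ) :=
    PiLp.continuous_ofLp 2 _
  exact key.continuous_comp hof

lemma tendstoInDistribution_real_of_tendsto_charFun [IsProbabilityMeasure P]
    [IsProbabilityMeasure P'] {X : ℕ → Ω → ℝ} {Z : Ω' → ℝ}
    (hX : ∀ n, Measurable (X n)) (hZ : Measurable Z)
    (h : ∀ z : ℝ, Tendsto (fun n => charFun (P.map (X n)) z) atTop (𝓝 (charFun (P'.map Z) z))) :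
    TendstoInDistribution X atTop Z (fun _ => P) P' :=
  ⟨fun n => (hX n).aemeasurable, hZ.aemeasurable,
    ProbabilityMeasure.tendsto_of_tendsto_charFun h⟩

end Convergence

/-! ### The two regimes -/

section Main

variable {Ω : Type*} [MeasurableSpace Ω] {P : Measure Ω} [IsProbabilityMeasure P]
  {L : Set (ℝ × ℝ) → Ω → ℝ} {γ b : ℝ} {ν : Measure ℝ} {a a' : ℝ → ℝ} {κ c β Kp Km : ℝ}

lemma IsLongMemoryTrawl.shortScale_pos (ha : IsLongMemoryTrawl a a' κ c) (hβ : 1 < β)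
    (hβκ : β < κ - 1) : 0 < shortScale a' β := by
  have hint := ha.integrableOn_rpow_mul (by linarith : 0 ≤ β) hβκ
  have hpos : ∀ s ∈ Set.Ioi (0 : ℝ), 0 < s ^ β * a' s := fun s hs =>
    mul_pos (Real.rpow_pos_of_pos hs _) (ha.pos s (le_of_lt hs))
  rw [shortScale, setIntegral_pos_iff_support_of_nonneg_ae
    ((ae_restrict_mem measurableSet_Ioi).mono fun s hs => (hpos s hs).le) hint]
  have : Set.Ioi (0 : ℝ) ⊆ Function.support fun s => s ^ β * a' s :=
    fun s hs => (hpos s hs).ne'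
  rw [Set.inter_eq_right.2 this]
  simp

lemma IsStrictlyStableTriplet.smul (h : IsStrictlyStableTriplet β Kp Km γ b ν) {ρ : ℝ}
    (hρ : 0 < ρ) : IsStrictlyStableTriplet β (ρ * Kp) (ρ * Km) (ρ * γ) 0
      (stableLevyMeasure β (ρ * Kp) (ρ * Km)) where
  index_pos := h.index_pos
  index_lt_two := h.index_lt_two
  Kp_nonneg := mul_nonneg hρ.le h.Kp_nonneg
  Km_nonneg := mul_nonneg hρ.le h.Km_nonneg
  sum_pos := by rw [← mul_add]; exact mul_pos hρ h.sum_pos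
  no_gaussian := rfl
  levyMeasure_eq := rfl
  drift_eq hβ := by rw [h.drift_eq hβ]; ring
  symmetric hβ := by rw [h.symmetric hβ]

lemma IsStrictlyStableTriplet.isHomogeneousExponent (h : IsStrictlyStableTriplet β Kp Km γ b ν)
    (hβ : 1 < β) : IsHomogeneousExponent β (levyExponent γ b ν) := by
  rw [h.no_gaussian, h.levyMeasure_eq]
  exact isHomogeneousExponent_levyExponent hβ h.index_lt_two h.Kp_nonneg h.Km_nonneg
    (h.drift_eq hβ.ne')

lemma IsStrictlyStableTriplet.levyExponent_smul (h : IsStrictlyStableTriplet β Kp Km γ b ν)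
    (hβ : 1 < β) {ρ : ℝ} (hρ : 0 ≤ ρ) (z : ℝ) :
    levyExponent (ρ * γ) 0 (stableLevyMeasure β (ρ * Kp) (ρ * Km)) z =
      ρ * levyExponent γ b ν z := by
  rw [h.no_gaussian, h.levyMeasure_eq]
  exact levyExponent_stable_smul hβ h.index_lt_two h.Kp_nonneg h.Km_nonneg (h.drift_eq hβ.ne') hρ z

lemma isStrictlyStableLaw_strip (hL : IsHomogeneousLevyBasis P L γ b ν)
    (h : IsStrictlyStableTriplet β Kp Km γ b ν) (hβ : 1 < β) {ρ : ℝ} (hρ : 0 < ρ) :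
    IsStrictlyStableLaw (P.map (L (strip 0 ρ))) β (ρ * Kp) (ρ * Km) (ρ * γ) := by
  refine ⟨Measure.isProbabilityMeasure_map (hL.measurable_strip _ _).aemeasurable, h.smul hρ,
    fun z => ?_⟩
  rw [hL.charFun_strip hρ.le, h.levyExponent_smul hβ hρ.le, sub_zero]

theorem isStrictlyStableLevyProcess_strip (hL : IsHomogeneousLevyBasis P L γ b ν)
    (h : IsStrictlyStableTriplet β Kp Km γ b ν) (hβ : 1 < β) {ρ : ℝ} (hρ : 0 < ρ) :
    IsStrictlyStableLevyProcess (fun t : ℝ≥0 => L (strip 0 (ρ * t))) P β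
      (ρ * Kp) (ρ * Km) (ρ * γ) := by
  refine ⟨hL.isLevyProcess_strip (h.isHomogeneousExponent hβ).continuous hρ.le, ?_⟩
  simpa using isStrictlyStableLaw_strip hL h hβ hρ

/-- Convergence of the finite-dimensional distributions in the regime `1 < β < κ - 1`. -/
theorem tendstoFDD_partialSumProcess (hL : IsHomogeneousLevyBasis P L γ b ν)
    (h : IsStrictlyStableTriplet β Kp Km γ b ν) (ha : IsLongMemoryTrawl a a' κ c) (hβ : 1 < β)
    (hβκ : β < κ - 1) {Δ : ℕ → ℝ} (hΔ : ∀ n, 0 ≤ Δ n) (hΔ0 : Tendsto Δ atTop (𝓝 0))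
    (hΔT : Tendsto (fun n : ℕ => (n : ℝ) * Δ n) atTop atTop)
    {Ω' : Type*} [MeasurableSpace Ω'] {P' : Measure Ω'} [IsProbabilityMeasure P']
    {Y : ℝ≥0 → Ω' → ℝ}
    (hY : IsStrictlyStableLevyProcess Y P' β (shortScale a' β * Kp) (shortScale a' β * Km)
      (shortScale a' β * γ)) :
    TendstoFDD (fun n t ω => Δ n / ((n : ℝ) * Δ n) ^ (1 / β) * partialSumProcess P L a Δ n t ω)
      Y P P' := by
  intro k t
  have hψ := h.isHomogeneousExponent hβ
  set ψ := levyExponent γ b ν with hψdef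
  have hρ := ha.shortScale_pos hβ hβκ
  set ρ := shortScale a' β with hρdef
  have hψ0 : ψ 0 = 0 := levyExponent_zero _ _ _
  refine tendstoInDistribution_of_tendsto_charFun
    (fun n => measurable_pi_lambda _ fun j => (measurable_partialSum hL ha _ _).const_mul _)
    (measurable_pi_lambda _ fun j => hY.1.measurable (t j)) fun θ => ?_
  have hmarg := hY.1.charFun_eq (ψ := fun z => (ρ : ℂ) * ψ z)
    (continuous_const.mul hψ.continuous) (by simp [hψ0]) fun z => by
      rw [hY.2.2.2 z, h.levyExponent_smul hβ hρ.le]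
  rw [hY.1.integral_exp_sum (ψ := fun z => (ρ : ℂ) * ψ z) (by simp [hψ0]) hmarg,
    integral_const_mul]
  have hlim := tendsto_integral_shortScale ha hβ hβκ hψ θ (fun j => (t j : ℝ)) hΔ hΔ0 hΔT
    (m := fun j n => ⌊(n : ℝ≥0) * t j⌋₊)
    (fun n j => by
      have := Nat.floor_le (zero_le : 0 ≤ (n : ℝ≥0) * t j)
      exact_mod_cast this)
    (fun n j => by
      have := (Nat.lt_floor_add_one ((n : ℝ≥0) * t j)).le
      exact_mod_cast this)
  refine ((Complex.continuous_exp.tendsto _).comp hlim).congr' ?_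
  filter_upwards [hΔT.eventually_gt_atTop 0] with n hn
  set T := (n : ℝ) * Δ n with hT
  have hexp : ∀ ω, ∑ j, θ j * (Δ n / T ^ (1 / β) * partialSumProcess P L a Δ n (t j) ω) =
      ∑ j, (θ j * (Δ n / T ^ (1 / β))) * partialSum P L a (Δ n) ⌊(n : ℝ≥0) * t j⌋₊ ω := by
    intro ω
    refine Finset.sum_congr rfl fun j _ => ?_
    rw [partialSumProcess, mul_assoc]
  simp only [Function.comp_apply, hexp]
  rw [integral_exp_sum_partialSum hL ha hβ hψ]
  congr 1
  refine setIntegral_congr_fun measurableSet_Ioi fun s _ => ?_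
  congr 1
  -- By homogeneity the normalisation becomes `T⁻¹`, which is exactly the Jacobian of `r = T x`.
  have hpow : ((T ^ (1 / β))⁻¹) ^ β = T⁻¹ := by
    rw [← Real.inv_rpow hn.le, ← Real.rpow_mul (by positivity),
      one_div_mul_cancel (by linarith), Real.rpow_one]
  have hg : ∀ r, ψ (∑ j, θ j * (Δ n / T ^ (1 / β)) * gridCount (Δ n) ⌊(n : ℝ≥0) * t j⌋₊ r s) =
      ((T⁻¹ : ℝ) : ℂ) * ψ (gridSum θ (Δ n) (fun j => ⌊(n : ℝ≥0) * t j⌋₊) r s) := by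
    intro r
    rw [← hpow, ← hψ.map_mul _ (by positivity), gridSum, Finset.mul_sum]
    congr 1
    refine Finset.sum_congr rfl fun j _ => ?_
    ring
  rw [Measure.integral_comp_mul_left
    (fun r => ψ (gridSum θ (Δ n) (fun j => ⌊(n : ℝ≥0) * t j⌋₊) r s)) T]
  rw [abs_of_pos (inv_pos.2 hn), Complex.real_smul, ← integral_const_mul]
  exact integral_congr_ae (ae_of_all _ fun r => (hg r).symm)

/-- Convergence in distribution in the regime `κ - 1 < β < 2`. -/
theorem tendstoInDistribution_partialSumProcess (hL : IsHomogeneousLevyBasis P L γ b ν)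
    (h : IsStrictlyStableTriplet β Kp Km γ b ν) (ha : IsLongMemoryTrawl a a' κ c)
    (hβκ : κ - 1 < β) (hβ2 : β < 2) {Δ : ℕ → ℝ} (hΔ : ∀ n, 0 ≤ Δ n)
    (hΔ0 : Tendsto Δ atTop (𝓝 0))
    (hΔT : Tendsto (fun n : ℕ => (n : ℝ) * Δ n) atTop atTop)
    {Ω' : Type*} [MeasurableSpace Ω'] {P' : Measure Ω'} [IsProbabilityMeasure P'] {ξ : Ω' → ℝ}
    (hξ : Measurable ξ)
    (hlaw : IsStrictlyStableLaw (P'.map ξ) β (longScale κ β * Kp) (longScale κ β * Km)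
      (longScale κ β * γ)) :
    TendstoInDistribution (fun (n : ℕ) (ω : Ω) =>
        1 / ((n : ℝ) * (a ((n : ℝ) * Δ n) * ((n : ℝ) * Δ n)) ^ (1 / β)) *
          partialSumProcess P L a Δ n 1 ω) atTop ξ (fun _ => P) P' := by
  have hβ : 1 < β := by linarith [ha.two_lt]
  have hψ := h.isHomogeneousExponent hβ
  have hmeas : ∀ n : ℕ, Measurable fun ω =>
      1 / ((n : ℝ) * (a ((n : ℝ) * Δ n) * ((n : ℝ) * Δ n)) ^ (1 / β)) *
          partialSumProcess P L a Δ n 1 ω :=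
    fun n => (measurable_partialSum hL ha _ _).const_mul _
  refine tendstoInDistribution_real_of_tendsto_charFun hmeas hξ fun z => ?_
  rw [hlaw.2.2 z, h.levyExponent_smul hβ (longScale_pos ha.two_lt).le]
  have hlim := tendsto_integral_longScale ha hβκ hβ2 hψ z hΔ hΔ0 hΔT
  refine ((Complex.continuous_exp.tendsto _).comp hlim).congr fun n => ?_
  set q := 1 / ((n : ℝ) * (a ((n : ℝ) * Δ n) * ((n : ℝ) * Δ n)) ^ (1 / β)) with hq
  -- The one-dimensional law is the case of a one-point index type.
  have h1 := integral_exp_sum_partialSum hL ha hβ hψ (fun _ : Unit => z * q) (Δ n) fun _ => n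
  simp only [Finset.univ_unique, Finset.sum_const, Finset.card_singleton, one_smul] at h1
  rw [Function.comp_apply, ← h1, charFun_apply_real,
    integral_map (hmeas n).aemeasurable (by fun_prop)]
  refine integral_congr_ae (ae_of_all _ fun ω => ?_)
  have hfl : ⌊(n : ℝ≥0) * 1⌋₊ = n := by simp
  simp only [partialSumProcess, hfl, ← hq]
  clear_value q
  push_cast
  ring_nf

end Main

end TrawlLimit

/-! ### The main theorem. -/

theorem mainTheorem6
    {Ω : Type u} [MeasurableSpace Ω] (P : Measure Ω) [IsProbabilityMeasure P]
    (L : Set (ℝ × ℝ) → Ω → ℝ) (γ b : ℝ) (ν : Measure ℝ) (β Kp Km : ℝ)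
    (hL : TrawlLimit.IsHomogeneousLevyBasis P L γ b ν)
    (hstable : TrawlLimit.IsStrictlyStableTriplet β Kp Km γ b ν)
    (a a' : ℝ → ℝ) (κ c : ℝ) (ha : TrawlLimit.IsLongMemoryTrawl a a' κ c)
    (Δ : ℕ → ℝ) (hΔ_nonneg : ∀ n, 0 ≤ Δ n) (hΔ_zero : Tendsto Δ atTop (𝓝 0))
    (hΔ_top : Tendsto (fun n : ℕ => (n : ℝ) * Δ n) atTop atTop) :
    (1 < β → β < κ - 1 →
      IntegrableOn (fun s => s ^ β * a' s) (Set.Ioi 0) ∧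
      (∃ (Ω' : Type u) (_ : MeasurableSpace Ω') (P' : Measure Ω') (_ : IsProbabilityMeasure P')
        (Y : ℝ≥0 → Ω' → ℝ),
        TrawlLimit.IsStrictlyStableLevyProcess Y P' β
          (TrawlLimit.shortScale a' β * Kp) (TrawlLimit.shortScale a' β * Km)
          (TrawlLimit.shortScale a' β * γ)) ∧
      ∀ (Ω' : Type u) (_ : MeasurableSpace Ω') (P' : Measure Ω') (_ : IsProbabilityMeasure P')
        (Y : ℝ≥0 → Ω' → ℝ),
        TrawlLimit.IsStrictlyStableLevyProcess Y P' β
          (TrawlLimit.shortScale a' β * Kp) (TrawlLimit.shortScale a' β * Km)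
          (TrawlLimit.shortScale a' β * γ) →
        TrawlLimit.TendstoFDD
          (fun n t ω => Δ n / ((n : ℝ) * Δ n) ^ (1 / β) *
            TrawlLimit.partialSumProcess P L a Δ n t ω) Y P P') ∧
    (κ - 1 < β → β < 2 →
      ∃ (Ω' : Type u) (_ : MeasurableSpace Ω') (P' : Measure Ω') (_ : IsProbabilityMeasure P')
        (ξ : Ω' → ℝ),
        Measurable ξ ∧
        TrawlLimit.IsStrictlyStableLaw (P'.map ξ) β
          (TrawlLimit.longScale κ β * Kp) (TrawlLimit.longScale κ β * Km)
          (TrawlLimit.longScale κ β * γ) ∧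
        TendstoInDistribution
          (fun (n : ℕ) (ω : Ω) =>
            1 / ((n : ℝ) * (a ((n : ℝ) * Δ n) * ((n : ℝ) * Δ n)) ^ (1 / β)) *
              TrawlLimit.partialSumProcess P L a Δ n 1 ω)
          atTop ξ (fun _ => P) P') := by
  refine ⟨fun hβ hβκ => ⟨ha.integrableOn_rpow_mul (by linarith) hβκ, ?_, ?_⟩, fun hβκ hβ2 => ?_⟩
  -- The limit process is realised on the original space, from the values of `L` on strips; the same
  -- is done for `ξ`.
  · exact ⟨Ω, inferInstance, P, inferInstance, _,
      TrawlLimit.isStrictlyStableLevyProcess_strip hL hstable hβ (ha.shortScale_pos hβ hβκ)⟩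
  · intro Ω' _ P' _ Y hY
    exact TrawlLimit.tendstoFDD_partialSumProcess hL hstable ha hβ hβκ hΔ_nonneg hΔ_zero hΔ_top hY
  · have hβ : 1 < β := by linarith [ha.two_lt]
    have hlaw := TrawlLimit.isStrictlyStableLaw_strip hL hstable hβ
      (TrawlLimit.longScale_pos (β := β) ha.two_lt)
    exact ⟨Ω, inferInstance, P, inferInstance, _, hL.measurable_strip _ _, hlaw,
      TrawlLimit.tendstoInDistribution_partialSumProcess hL hstable ha hβκ hβ2 hΔ_nonneg hΔ_zero
        hΔ_top (hL.measurable_strip _ _) hlaw⟩
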